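/- Let $\mathbb{T}^2=(\mathbb{R}/2\pi\mathbb{Z})^2$. For $f\in L^2(\mathbb{T}^2)$ put $\widehat f(k)=(2\pi)^{-2}\int_{\mathbb{T}^2}f(x)e^{-ik\cdot x}\,dx$, $k\in\mathbb{Z}^2$, and $\langle k\rangle=\sqrt{1+|k|^2}$. For $s\ge 0$, $H^s(\mathbb{T}^2)$ is the space of $f\in L^2(\mathbb{T}^2)$ with $$\|f\|_{H^s}:=2\pi\Big(\sum_{k\in\mathbb{Z}^2}\langle k\rangle^{2s}|\widehat f(k)|^2\Big)^{1/2}<\infty .$$ For a real function $\rho$ and a real vector field $v=(v_1,v_2)$ on $\mathbb{T}^2$ put $\|(\rho,v)\|_{M^s}:=\|\rho\|_{H^s}+\|v\|_{H^{s-1}}$, where $\|v\|_{H^{s-1}}^2=\|v_1\|_{H^{s-1}}^2+\|v_2\|_{H^{s-1}}^2$. **Proposition 2.1.** Let $s>1$ and $m>0$. There is a constant $M=M(s,m)>1$, depending only on $s$ and $m$, such that the following holds for all $\varepsilon\in(0,1]$, all $\varphi\in\mathbb{R}$ and all $u\in H^s(\mathbb{T}^2;\mathbb{C})$ with $$\|u-\sqrt{m}\,e^{i\varphi}\|_{L^\infty}\le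 \frac{\sqrt m}{2}.$$ The function $u$ can be written (almost everywhere) as $u=|u|e^{i\theta}$ with a continuous phase $\theta:\mathbb{T}^2\to\mathbb{R}$ that has an integrable weak gradient $\nabla\theta$. For every such $\theta$, the Madelung transform $\rho:=|u|^2$, $v:=\varepsilon\nabla\theta$ of $u$ satisfies $\rho\in H^s(\mathbb{T}^2)$, $v\in H^{s-1}(\mathbb{T}^2;\mathbb{R}^2)$ and $$M^{-1}\,\|(\rho,v)\|_{M^s}\le \|u\|_{H^s}\le M\,\varepsilon^{-1}\,\|(\rho,v)\|_{M^s}.$$ -/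

import Mathlib

open MeasureTheory
open scoped ENNReal ContDiff

/-- `2π` is positive, so that `ℝ / 2πℤ` carries its Lebesgue measure (of total mass `2π`). -/
instance fact_zero_lt_two_pi : Fact ((0 : ℝ) < 2 * Real.pi) := ⟨Real.two_pi_pos⟩

/-- The torus `𝕋² = (ℝ / 2πℤ)²`; its `volume` is the Lebesgue measure `dx`, of mass `(2π)²`. -/
abbrev Torus2 : Type := Fin 2 → AddCircle (2 * Real.pi)

/-- The Fourier coefficient `(2π)⁻² ∫ f(x) e^{-i k·x} dx`. -/
noncomputable def torusFourierCoeff (f : Torus2 → ℂ) (k : Fin 2 → ℤ) : ℂ :=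
  (((2 * Real.pi) ^ 2 : ℝ) : ℂ)⁻¹ * ∫ x : Torus2, f x * ∏ j : Fin 2, fourier (-(k j)) (x j)

/-- The squared Japanese bracket `⟨k⟩² = 1 + |k|²`. -/
noncomputable def japaneseSq (k : Fin 2 → ℤ) : ℝ := 1 + ∑ j : Fin 2, (k j : ℝ) ^ 2

/-- `f ∈ H^s(𝕋²)`, for `s ≥ 0`: `f ∈ L²` and the coefficients `⟨k⟩^s f̂(k)` of `J^s f` are
square summable. -/
def MemHs (s : ℝ) (f : Torus2 → ℂ) : Prop :=
  MemLp f 2 volume ∧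
    Summable fun k : Fin 2 → ℤ => japaneseSq k ^ s * ‖torusFourierCoeff f k‖ ^ 2

/-- `‖f‖_{H^s} = ‖J^s f‖_{L²(dx)} = 2π (∑ₖ ⟨k⟩^{2s} |f̂(k)|²)^{1/2}`, for `f ∈ H^s`. -/
noncomputable def hsNorm (s : ℝ) (f : Torus2 → ℂ) : ℝ :=
  2 * Real.pi *
    Real.sqrt (∑' k : Fin 2 → ℤ, japaneseSq k ^ s * ‖torusFourierCoeff f k‖ ^ 2)

/-- A function on the torus is smooth if its periodic lift to `ℝ²` is `C^∞`. -/
def TorusSmooth (ψ : Torus2 → ℝ) : Prop :=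
  ContDiff ℝ ∞ fun y : Fin 2 → ℝ => ψ fun j => (y j : AddCircle (2 * Real.pi))

/-- The classical partial derivative `∂_j ψ` on the torus. -/
noncomputable def torusPartial (j : Fin 2) (ψ : Torus2 → ℝ) (x : Torus2) : ℝ :=
  deriv (fun t : ℝ => ψ (x + Pi.single j (t : AddCircle (2 * Real.pi)))) 0

/-- The integrable vector field `g` is the weak (distributional) gradient `∇θ` of the integrable
function `θ`. -/
def IsWeakGradient (θ : Torus2 → ℝ) (g : Fin 2 → Torus2 → ℝ) : Prop :=
  Integrable θ volume ∧ ∀ j : Fin 2, Integrable (g j) volume ∧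
    ∀ ψ : Torus2 → ℝ, TorusSmooth ψ →
      ∫ x : Torus2, θ x * torusPartial j ψ x = -∫ x : Torus2, g j x * ψ x

/-- `(ρ, v)` is the Madelung transform `ρ = |u|²`, `v = ε∇θ` of `u = |u| e^{iθ}`, where the
phase `θ` is real-valued and continuous on the torus. -/
def IsMadelungTransform (ε : ℝ) (u : Torus2 → ℂ) (ρ : Torus2 → ℝ)
    (v : Fin 2 → Torus2 → ℝ) : Prop :=
  (∀ x, ρ x = ‖u x‖ ^ 2) ∧
  ∃ (θ : Torus2 → ℝ) (g : Fin 2 → Torus2 → ℝ), Continuous θ ∧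
    (∀ᵐ x : Torus2, u x = (‖u x‖ : ℂ) * Complex.exp (Complex.I * (θ x : ℂ))) ∧
    IsWeakGradient θ g ∧ ∀ j x, v j x = ε * g j x

/-- `(ρ, v) ∈ H^s × H^{s-1}`, the velocity being taken componentwise. -/
def MemMs (s : ℝ) (ρ : Torus2 → ℝ) (v : Fin 2 → Torus2 → ℝ) : Prop :=
  MemHs s (fun x => (ρ x : ℂ)) ∧ ∀ j : Fin 2, MemHs (s - 1) (fun x => (v j x : ℂ))

/-- `‖(ρ, v)‖_{M^s} = ‖ρ‖_{H^s} + ‖v‖_{H^{s-1}}`, where `‖v‖² = ‖v₁‖² + ‖v₂‖²`. -/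
noncomputable def msNorm (s : ℝ) (ρ : Torus2 → ℝ) (v : Fin 2 → Torus2 → ℝ) : ℝ :=
  hsNorm s (fun x => (ρ x : ℂ)) +
    Real.sqrt (∑ j : Fin 2, hsNorm (s - 1) (fun x => (v j x : ℂ)) ^ 2)

open Filter Topology ComplexConjugate

/-! ### Exponential monomials on the torus -/

/-! Put `r = √m` and `c = r e^{iφ}`. The hypothesis keeps `u/c` in the disc of radius `1/2` about
`1`, where the principal logarithm is analytic, and there `u = c · exp(½ log(|u|²/r²) + i
arg(u/c))`. Thus `arg(u/c)` is the imaginary part of an analytic function of `u`, the density is `u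
ū`, and `u` is recovered from the two by a logarithm and an exponential. Both inequalities follow
once composition with an analytic function is bounded on bounded functions in `H^s`, linearly in the
`H^s` norm. All estimates are uniform over `c` with `|c| = r`, so `φ` does not enter the constants.

The composition bound rests on the tame product estimate `exists_hsENorm_mul_le`. Bounded `f` and
`g` are replaced by trigonometric polynomials `P`, `Q` of degree `3n` with comparable sup bounds.
Since `PQ` has degree `6n`, the Fourier tail of `fg` beyond `6n` is controlled by the tails of `f`
and `g` beyond `n`, and a dyadic sum over `n` rebuilds the `H^s` norm. Repeated halving of the
exponent then gives `‖wⁿ‖ ≤ n^A r^(n-1) ‖w‖` when `|w| ≤ r` (`exists_hsENorm_pow_le`). The loss is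
only polynomial, so power series may be used on their whole disc of convergence
(`exists_hsENorm_powerSeries_le`).

Phase and velocity are compared on the Fourier side, where a weak gradient multiplies coefficients
by `i k_j`. Only the zeroth mode is lost, and for `arg(u/c)` it is at most `π`. Additive constants
like this one are absorbed because `|u|` is bounded below: the zeroth modes of `u` and `|u|²` are at
least `r/2` and `r²/4` in modulus (`ofReal_le_hsENorm`, `one_le_hsENorm_normSq`).

For `s > 1` the Fourier series of `u` converges absolutely, so `u` has a continuous representative
and `arg(u/c)` a continuous version. Connectedness of the torus makes every other continuous phase
differ from it by a constant (`phase_unique`), so all phases have the same gradient. The parameter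
`ε` enters only through `v = ε∇θ`. -/

/-- The exponential monomial `e^{i k·x}`. -/
noncomputable def torusMonomial (k : Fin 2 → ℤ) : C(Torus2, ℂ) where
  toFun x := ∏ j, fourier (k j) (x j)
  continuous_toFun := by fun_prop

lemma torusMonomial_apply (k : Fin 2 → ℤ) (x : Torus2) :
    torusMonomial k x = ∏ j, fourier (k j) (x j) := rfl

lemma torusMonomial_neg (k : Fin 2 → ℤ) (x : Torus2) :
    torusMonomial (-k) x = conj (torusMonomial k x) := by
  simp only [torusMonomial_apply, Pi.neg_apply, fourier_neg, map_prod]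

lemma torusMonomial_add (k l : Fin 2 → ℤ) (x : Torus2) :
    torusMonomial (k + l) x = torusMonomial k x * torusMonomial l x := by
  simp only [torusMonomial_apply, Pi.add_apply, fourier_add, ← Finset.prod_mul_distrib]

lemma torusMonomial_zero (x : Torus2) : torusMonomial 0 x = 1 := by
  simp only [torusMonomial_apply, Pi.zero_apply, fourier_zero, Finset.prod_const_one]

lemma torusMonomial_arg_add (k : Fin 2 → ℤ) (x y : Torus2) :
    torusMonomial k (x + y) = torusMonomial k x * torusMonomial k y := by
  simp only [torusMonomial_apply, ← Finset.prod_mul_distrib, fourier_apply, Pi.add_apply,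
    smul_add, AddCircle.toCircle_add, Circle.coe_mul]

lemma norm_torusMonomial_apply (k : Fin 2 → ℤ) (x : Torus2) : ‖torusMonomial k x‖ = 1 := by
  simp only [torusMonomial_apply, fourier_apply, norm_prod, Circle.norm_coe, Finset.prod_const_one]

lemma integral_fourier_volume (n : ℤ) :
    ∫ x : AddCircle (2 * Real.pi), fourier n x = if n = 0 then (2 * Real.pi : ℂ) else 0 := by
  have h := congrFun (fourierCoeff_fourier (T := 2 * Real.pi) n) 0
  simp only [fourierCoeff, neg_zero, fourier_zero, one_smul] at h
  rw [AddCircle.integral_haarAddCircle] at h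
  have h2 : ((2 * Real.pi : ℝ) : ℂ) ≠ 0 := by exact_mod_cast Real.two_pi_pos.ne'
  rw [Complex.real_smul, Complex.ofReal_inv, inv_mul_eq_iff_eq_mul₀ h2] at h
  rw [h]
  by_cases hn : n = 0
  · simp [hn]
  · rw [Pi.single_eq_of_ne (by tauto)]; simp [hn]

lemma integral_torusMonomial (k : Fin 2 → ℤ) :
    ∫ x, torusMonomial k x = if k = 0 then (((2 * Real.pi) ^ 2 : ℝ) : ℂ) else 0 := by
  simp only [torusMonomial_apply]
  rw [integral_fintype_prod_volume_eq_prod (f := fun j (x : AddCircle (2 * Real.pi)) =>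
    (fourier (k j) x : ℂ))]
  simp only [integral_fourier_volume]
  by_cases hk : k = 0
  · subst hk; simp
  · obtain ⟨i, hi⟩ := Function.ne_iff.mp hk
    rw [if_neg hk]
    apply Finset.prod_eq_zero (Finset.mem_univ i)
    rw [if_neg (show ¬k i = 0 from hi)]

lemma volume_real_torus : (volume : Measure Torus2).real Set.univ = (2 * Real.pi) ^ 2 := by
  have := integral_torusMonomial 0
  simp only [torusMonomial_zero, if_true, integral_const] at this
  rw [Complex.real_smul, mul_one] at this
  exact Complex.ofReal_injective this

/-! ### Fourier coefficients -/

lemma torusFourierCoeff_eq (f : Torus2 → ℂ) (k : Fin 2 → ℤ) :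
    torusFourierCoeff f k =
      (((2 * Real.pi) ^ 2 : ℝ) : ℂ)⁻¹ * ∫ x, f x * torusMonomial (-k) x := rfl

lemma two_pi_sq_ne_zero : (((2 * Real.pi) ^ 2 : ℝ) : ℂ) ≠ 0 := by
  exact_mod_cast (pow_pos Real.two_pi_pos 2).ne'

lemma torusFourierCoeff_congr_ae {f g : Torus2 → ℂ} (h : f =ᵐ[volume] g) :
    torusFourierCoeff f = torusFourierCoeff g := by
  ext k
  simp only [torusFourierCoeff_eq]
  congr 1
  apply integral_congr_ae
  filter_upwards [h] with x hx
  rw [hx]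

lemma MeasureTheory.Integrable.mul_torusMonomial {f : Torus2 → ℂ} (hf : Integrable f)
    (k : Fin 2 → ℤ) : Integrable (fun x => f x * torusMonomial k x) :=
  hf.mul_bdd (c := 1) (torusMonomial k).continuous.aestronglyMeasurable
    (ae_of_all _ fun x => (norm_torusMonomial_apply k x).le)

lemma torusFourierCoeff_add {f g : Torus2 → ℂ} (hf : Integrable f) (hg : Integrable g)
    (k : Fin 2 → ℤ) :
    torusFourierCoeff (fun x => f x + g x) k = torusFourierCoeff f k + torusFourierCoeff g k := by
  simp only [torusFourierCoeff_eq, add_mul]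
  rw [integral_add (hf.mul_torusMonomial _) (hg.mul_torusMonomial _), mul_add]

lemma torusFourierCoeff_sub {f g : Torus2 → ℂ} (hf : Integrable f) (hg : Integrable g)
    (k : Fin 2 → ℤ) :
    torusFourierCoeff (fun x => f x - g x) k = torusFourierCoeff f k - torusFourierCoeff g k := by
  simp only [torusFourierCoeff_eq, sub_mul]
  rw [integral_sub (hf.mul_torusMonomial _) (hg.mul_torusMonomial _), mul_sub]

lemma torusFourierCoeff_const_mul (c : ℂ) (f : Torus2 → ℂ) (k : Fin 2 → ℤ) :
    torusFourierCoeff (fun x => c * f x) k = c * torusFourierCoeff f k := by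
  simp only [torusFourierCoeff_eq, mul_assoc]
  rw [integral_const_mul]; ring

lemma torusFourierCoeff_sum {ι : Type*} (S : Finset ι) (f : ι → Torus2 → ℂ)
    (hf : ∀ i ∈ S, Integrable (f i)) (k : Fin 2 → ℤ) :
    torusFourierCoeff (fun x => ∑ i ∈ S, f i x) k = ∑ i ∈ S, torusFourierCoeff (f i) k := by
  simp only [torusFourierCoeff_eq, Finset.sum_mul]
  rw [integral_finsetSum _ (fun i hi => (hf i hi).mul_torusMonomial _), Finset.mul_sum]

lemma torusFourierCoeff_conj (f : Torus2 → ℂ) (k : Fin 2 → ℤ) :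
    torusFourierCoeff (fun x => conj (f x)) k = conj (torusFourierCoeff f (-k)) := by
  simp only [torusFourierCoeff_eq, map_mul, map_inv₀, Complex.conj_ofReal, neg_neg]
  rw [← integral_conj]
  simp only [map_mul, ← torusMonomial_neg]

lemma torusFourierCoeff_monomial (l k : Fin 2 → ℤ) :
    torusFourierCoeff (torusMonomial l) k = if k = l then 1 else 0 := by
  simp only [torusFourierCoeff_eq, ← torusMonomial_add, integral_torusMonomial]
  have : l + -k = 0 ↔ k = l := by rw [← sub_eq_add_neg, sub_eq_zero, eq_comm]
  simp only [this]
  split_ifs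
  · exact inv_mul_cancel₀ two_pi_sq_ne_zero
  · simp

lemma torusFourierCoeff_const (c : ℂ) (k : Fin 2 → ℤ) :
    torusFourierCoeff (fun _ => c) k = if k = 0 then c else 0 := by
  have h := torusFourierCoeff_monomial 0 k
  have h2 := torusFourierCoeff_const_mul c (torusMonomial 0) k
  simp only [torusMonomial_zero, mul_one] at h2
  rw [h2, h]; simp

lemma torusFourierCoeff_norm_le {f : Torus2 → ℂ} {a : ℝ} (hf : ∀ᵐ x, ‖f x‖ ≤ a)
    (k : Fin 2 → ℤ) : ‖torusFourierCoeff f k‖ ≤ a := by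
  rw [torusFourierCoeff_eq, norm_mul, norm_inv, Complex.norm_real, Real.norm_eq_abs,
    abs_of_pos (by positivity)]
  have : ‖∫ x, f x * torusMonomial (-k) x‖ ≤ a * (volume : Measure Torus2).real Set.univ := by
    apply norm_integral_le_of_norm_le_const
    filter_upwards [hf] with x hx
    rw [norm_mul, norm_torusMonomial_apply, mul_one]; exact hx
  rw [volume_real_torus] at this
  rw [inv_mul_le_iff₀ (by positivity)]; linarith

/-! ### Completeness of the monomials -/

lemma torusMonomial_single (i : Fin 2) (x : Torus2) :
    torusMonomial (Pi.single i 1) x = fourier 1 (x i) := by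
  rw [torusMonomial_apply, Fin.prod_univ_two]
  fin_cases i <;> simp

/-- The star subalgebra generated by the monomials. -/
noncomputable def torusSubalgebra : StarSubalgebra ℂ C(Torus2, ℂ) where
  toSubalgebra := Algebra.adjoin ℂ (Set.range torusMonomial)
  star_mem' := by
    change Algebra.adjoin ℂ (Set.range torusMonomial) ≤
      star (Algebra.adjoin ℂ (Set.range torusMonomial))
    refine Algebra.adjoin_le ?_
    rintro _ ⟨n, rfl⟩
    refine Algebra.subset_adjoin ⟨-n, ?_⟩
    ext1 x
    simp only [torusMonomial_neg, starRingEnd_apply, ContinuousMap.star_apply]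

/-- Products of monomials are monomials, so the generated algebra is already their linear span; this
lets Stone–Weierstrass speak about the span. -/
lemma torusSubalgebra_coe :
    Subalgebra.toSubmodule torusSubalgebra.toSubalgebra =
      Submodule.span ℂ (Set.range torusMonomial) := by
  apply Algebra.adjoin_eq_span_of_subset
  refine .trans (fun x ↦ Submonoid.closure_induction (fun _ ↦ id) ⟨0, ?_⟩ ?_)
    Submodule.subset_span
  · ext z
    exact torusMonomial_zero z
  · rintro _ _ _ _ ⟨m, rfl⟩ ⟨n, rfl⟩
    exact ⟨m + n, ContinuousMap.ext fun z => torusMonomial_add m n z⟩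

lemma torusSubalgebra_separatesPoints : torusSubalgebra.SeparatesPoints := by
  intro x y hxy
  obtain ⟨i, hi⟩ := Function.ne_iff.mp hxy
  refine ⟨_, ⟨torusMonomial (Pi.single i 1), Algebra.subset_adjoin ⟨Pi.single i 1, rfl⟩, rfl⟩, ?_⟩
  dsimp only
  rw [torusMonomial_single, torusMonomial_single, fourier_one, fourier_one]
  contrapose! hi
  exact AddCircle.injective_toCircle Real.two_pi_pos.ne' (Circle.ext hi)

lemma span_torusMonomial_closure_eq_top :
    (Submodule.span ℂ (Set.range torusMonomial)).topologicalClosure = ⊤ := by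
  rw [← torusSubalgebra_coe]
  exact congr_arg (Subalgebra.toSubmodule <| StarSubalgebra.toSubalgebra ·)
    (ContinuousMap.starSubalgebra_topologicalClosure_eq_top_of_separatesPoints _
      torusSubalgebra_separatesPoints)

/-- The normalised monomials as elements of `L²`. -/
noncomputable def torusMonomialLp (k : Fin 2 → ℤ) : Lp ℂ 2 (volume : Measure Torus2) :=
  ContinuousMap.toLp (E := ℂ) 2 volume ℂ (((2 * Real.pi : ℝ) : ℂ)⁻¹ • torusMonomial k)

lemma coeFn_torusMonomialLp (k : Fin 2 → ℤ) :
    torusMonomialLp k =ᵐ[volume] fun x => ((2 * Real.pi : ℝ) : ℂ)⁻¹ * torusMonomial k x :=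
  ContinuousMap.coeFn_toLp volume _

lemma orthonormal_torusMonomialLp : Orthonormal ℂ torusMonomialLp := by
  rw [orthonormal_iff_ite]
  intro k l
  simp only [torusMonomialLp, ContinuousMap.inner_toLp, ContinuousMap.smul_apply, smul_eq_mul,
    map_mul, ← torusMonomial_neg]
  have : ∀ x : Torus2, ((2 * Real.pi : ℝ) : ℂ)⁻¹ * torusMonomial l x *
      (conj ((2 * Real.pi : ℝ) : ℂ)⁻¹ * torusMonomial (-k) x) =
      (((2 * Real.pi) ^ 2 : ℝ) : ℂ)⁻¹ * (torusMonomial l x * torusMonomial (-k) x) := by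
    intro x
    rw [map_inv₀, Complex.conj_ofReal, Complex.ofReal_pow, ← inv_pow]; ring
  simp only [this]
  rw [integral_const_mul, ← torusFourierCoeff_eq, torusFourierCoeff_monomial]

lemma span_torusMonomialLp_closure_eq_top :
    (Submodule.span ℂ (Set.range torusMonomialLp)).topologicalClosure = ⊤ := by
  have h := (ContinuousMap.toLp_denseRange ℂ (volume : Measure Torus2) ℂ
    (p := 2) (by simp)).topologicalClosure_map_submodule span_torusMonomial_closure_eq_top
  rw [← h]
  congr 1
  rw [Submodule.map_span, ← Set.range_comp]
  have h2 : ((2 * Real.pi : ℝ) : ℂ) ≠ 0 := by exact_mod_cast Real.two_pi_pos.ne'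
  apply le_antisymm
  · rw [Submodule.span_le]
    rintro _ ⟨k, rfl⟩
    rw [torusMonomialLp, map_smul]
    exact Submodule.smul_mem _ _ (Submodule.subset_span ⟨k, rfl⟩)
  · rw [Submodule.span_le]
    rintro _ ⟨k, rfl⟩
    have : (ContinuousMap.toLp (E := ℂ) 2 (volume : Measure Torus2) ℂ) (torusMonomial k) =
        ((2 * Real.pi : ℝ) : ℂ) • torusMonomialLp k := by
      rw [torusMonomialLp, map_smul, smul_smul, mul_inv_cancel₀ h2, one_smul]
    simp only [Function.comp_apply, SetLike.mem_coe]
    erw [this]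
    exact Submodule.smul_mem _ _ (Submodule.subset_span ⟨k, rfl⟩)

/-- The Hilbert basis of normalised monomials. -/
noncomputable def torusBasis : HilbertBasis (Fin 2 → ℤ) ℂ (Lp ℂ 2 (volume : Measure Torus2)) :=
  HilbertBasis.mk orthonormal_torusMonomialLp span_torusMonomialLp_closure_eq_top.ge

lemma torusBasis_repr (f : Lp ℂ 2 (volume : Measure Torus2)) (k : Fin 2 → ℤ) :
    torusBasis.repr f k = ((2 * Real.pi : ℝ) : ℂ) * torusFourierCoeff f k := by
  have h2 : ((2 * Real.pi : ℝ) : ℂ) ≠ 0 := by exact_mod_cast Real.two_pi_pos.ne'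
  rw [torusBasis.repr_apply_apply f k, MeasureTheory.L2.inner_def, torusBasis,
    HilbertBasis.coe_mk, torusFourierCoeff_eq, ← mul_assoc]
  have : ((2 * Real.pi : ℝ) : ℂ) * (((2 * Real.pi) ^ 2 : ℝ) : ℂ)⁻¹ =
      ((2 * Real.pi : ℝ) : ℂ)⁻¹ := by
    rw [Complex.ofReal_pow]; field_simp
  rw [this, ← integral_const_mul]
  apply integral_congr_ae
  filter_upwards [coeFn_torusMonomialLp k] with x hx
  simp only [RCLike.inner_apply, hx, map_mul, map_inv₀, Complex.conj_ofReal, torusMonomial_neg]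
  ring

/-- **Parseval's identity** for inner products on the torus. -/
lemma hasSum_conj_mul_torusFourierCoeff {f g : Torus2 → ℂ} (hf : MemLp f 2 volume)
    (hg : MemLp g 2 volume) :
    HasSum (fun k => conj (torusFourierCoeff f k) * torusFourierCoeff g k)
      ((((2 * Real.pi) ^ 2 : ℝ) : ℂ)⁻¹ * ∫ x, conj (f x) * g x) := by
  have h := torusBasis.hasSum_inner_mul_inner (hf.toLp f) (hg.toLp g)
  have h3 : inner ℂ (hf.toLp f) (hg.toLp g) = ∫ x, conj (f x) * g x := by
    rw [MeasureTheory.L2.inner_def]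
    apply integral_congr_ae
    filter_upwards [hf.coeFn_toLp, hg.coeFn_toLp] with x h1 h2
    rw [h1, h2, RCLike.inner_apply, mul_comm]
  rw [h3] at h
  convert! h.mul_left ((((2 * Real.pi) ^ 2 : ℝ) : ℂ)⁻¹) using 2 with k
  rw [← inner_conj_symm, ← torusBasis.repr_apply_apply, ← torusBasis.repr_apply_apply,
    torusBasis_repr, torusBasis_repr, torusFourierCoeff_congr_ae hf.coeFn_toLp,
    torusFourierCoeff_congr_ae hg.coeFn_toLp, map_mul, Complex.conj_ofReal]
  have h2 := two_pi_sq_ne_zero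
  rw [Complex.ofReal_pow] at h2 ⊢
  field_simp

lemma hasSum_sq_torusFourierCoeff {f : Torus2 → ℂ} (hf : MemLp f 2 volume) :
    HasSum (fun k => ‖torusFourierCoeff f k‖ ^ 2) (((2 * Real.pi) ^ 2)⁻¹ * ∫ x, ‖f x‖ ^ 2) := by
  have h := hasSum_conj_mul_torusFourierCoeff hf hf
  simp only [← Complex.normSq_eq_conj_mul_self, Complex.normSq_eq_norm_sq] at h
  rw [integral_complex_ofReal, ← Complex.ofReal_inv] at h
  have := Complex.hasSum_re h
  rw [← Complex.ofReal_mul] at this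
  simpa only [Complex.ofReal_re] using this

/-- The **Riesz–Fischer theorem** on the torus. -/
lemma exists_memLp_torusFourierCoeff_eq {c : (Fin 2 → ℤ) → ℂ} (hc : Summable fun k => ‖c k‖ ^ 2) :
    ∃ f : Torus2 → ℂ, MemLp f 2 volume ∧ ∀ k, torusFourierCoeff f k = c k := by
  have h2 : ((2 * Real.pi : ℝ) : ℂ) ≠ 0 := by exact_mod_cast Real.two_pi_pos.ne'
  have hmem : Memℓp (fun k => ((2 * Real.pi : ℝ) : ℂ) * c k) 2 := by
    apply memℓp_gen
    simp only [norm_mul, mul_pow, ENNReal.toReal_ofNat, Real.rpow_two]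
    exact hc.mul_left _
  refine ⟨torusBasis.repr.symm ⟨_, hmem⟩, Lp.memLp _, fun k => ?_⟩
  have := torusBasis_repr (torusBasis.repr.symm ⟨_, hmem⟩) k
  rw [LinearIsometryEquiv.apply_symm_apply] at this
  exact (mul_left_cancel₀ h2 this).symm

/-- An integrable function with vanishing Fourier coefficients vanishes. -/
lemma ae_eq_zero_of_torusFourierCoeff_eq_zero {f : Torus2 → ℂ} (hf : Integrable f)
    (h : ∀ k, torusFourierCoeff f k = 0) : f =ᵐ[volume] 0 := by
  have hmono : ∀ k, ∫ x, f x * torusMonomial k x = 0 := by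
    intro k
    have := h (-k)
    rw [torusFourierCoeff_eq, neg_neg] at this
    exact (mul_eq_zero.mp this).resolve_left (inv_ne_zero two_pi_sq_ne_zero)
  have hint : ∀ φ : C(Torus2, ℂ), Integrable (fun x => f x * φ x) := fun φ =>
    hf.mul_bdd (c := ‖φ‖) φ.continuous.aestronglyMeasurable (ae_of_all _ φ.norm_coe_le_norm)
  -- As `f` is only integrable, the Hilbert basis does not apply. Instead, integration against `f`
  -- is a continuous functional on `C(Torus2, ℂ)` that kills the dense span of the monomials.
  have hcont : ∀ φ : C(Torus2, ℂ), ∫ x, f x * φ x = 0 := by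
    let L : C(Torus2, ℂ) →ₗ[ℂ] ℂ :=
      { toFun := fun φ => ∫ x, f x * φ x
        map_add' := fun φ ψ => by
          simp only [ContinuousMap.add_apply, mul_add]
          exact integral_add (hint φ) (hint ψ)
        map_smul' := fun c φ => by
          simp only [ContinuousMap.smul_apply, smul_eq_mul, RingHom.id_apply]
          rw [← integral_const_mul]
          congr 1; ext x; ring }
    let L' : C(Torus2, ℂ) →L[ℂ] ℂ := L.mkContinuous (∫ x, ‖f x‖) (by
      intro φ
      calc ‖∫ x, f x * φ x‖ ≤ ∫ x, ‖f x‖ * ‖φ‖ := by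
            apply norm_integral_le_of_norm_le (hf.norm.mul_const _)
            exact ae_of_all _ fun x => by
              rw [norm_mul]; gcongr; exact φ.norm_coe_le_norm x
        _ = _ := integral_mul_const _ _)
    have hker : (Submodule.span ℂ (Set.range torusMonomial)) ≤ LinearMap.ker L'.toLinearMap := by
      rw [Submodule.span_le]
      rintro _ ⟨k, rfl⟩
      exact hmono k
    have hcl : IsClosed ((LinearMap.ker L'.toLinearMap : Submodule ℂ C(Torus2, ℂ)) :
        Set C(Torus2, ℂ)) := L'.isClosed_ker
    have := Submodule.topologicalClosure_minimal _ hker hcl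
    rw [span_torusMonomial_closure_eq_top] at this
    intro φ
    exact this (Submodule.mem_top (x := φ))
  apply ae_eq_zero_of_forall_setIntegral_isClosed_eq_zero hf
  intro F hF
  -- Continuous functions decreasing to the indicator of a closed set carry the vanishing over to
  -- integrals over closed sets, which determine `f` almost everywhere.
  have ht : Tendsto (fun n => ∫ x, f x * (((hF.apprSeq n x : NNReal) : ℝ) : ℂ)) atTop
      (𝓝 (∫ x, f x * F.indicator (fun _ => (1 : ℂ)) x)) := by
    apply tendsto_integral_of_dominated_convergence (fun x => ‖f x‖)
    · intro n
      exact hf.1.mul (Continuous.aestronglyMeasurable (by fun_prop))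
    · exact hf.norm
    · intro n
      refine ae_of_all _ fun x => ?_
      rw [norm_mul, Complex.norm_real, NNReal.norm_eq]
      have : ((hF.apprSeq n x : NNReal) : ℝ) ≤ 1 := by
        exact_mod_cast HasOuterApproxClosed.apprSeq_apply_le_one hF n x
      nlinarith [norm_nonneg (f x)]
    · refine ae_of_all _ fun x => ?_
      apply Tendsto.const_mul
      have := (tendsto_pi_nhds.mp (HasOuterApproxClosed.tendsto_apprSeq hF)) x
      have h3 : Continuous fun y : NNReal => (((y : NNReal) : ℝ) : ℂ) := by fun_prop
      convert! (h3.tendsto _).comp this using 2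
      by_cases hx : x ∈ F <;> simp [hx]
  have hz : ∀ n, ∫ x, f x * (((hF.apprSeq n x : NNReal) : ℝ) : ℂ) = 0 := fun n =>
    hcont ⟨fun x => (((hF.apprSeq n x : NNReal) : ℝ) : ℂ), by fun_prop⟩
  simp only [hz] at ht
  have := tendsto_nhds_unique ht tendsto_const_nhds
  rw [← integral_indicator hF.measurableSet, ← this]
  congr 1; ext x
  by_cases hx : x ∈ F <;> simp [hx]

/-! ### The Sobolev norm with values in `[0, ∞]` -/

lemma one_le_japaneseSq (k : Fin 2 → ℤ) : 1 ≤ japaneseSq k := by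
  unfold japaneseSq
  have : 0 ≤ ∑ j : Fin 2, (k j : ℝ) ^ 2 := Finset.sum_nonneg fun j _ => sq_nonneg _
  linarith

lemma japaneseSq_pos (k : Fin 2 → ℤ) : 0 < japaneseSq k := zero_lt_one.trans_le (one_le_japaneseSq k)

lemma japaneseSq_neg (k : Fin 2 → ℤ) : japaneseSq (-k) = japaneseSq k := by
  simp [japaneseSq]

/-- The Sobolev norm, up to the factor `2π`, with values in `[0, ∞]`. -/
noncomputable def hsENorm (s : ℝ) (f : Torus2 → ℂ) : ℝ≥0∞ :=
  eLpNorm (fun k => ((japaneseSq k ^ (s / 2) : ℝ) : ℂ) * torusFourierCoeff f k) 2 Measure.count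

lemma aestronglyMeasurable_count (c : (Fin 2 → ℤ) → ℂ) :
    AEStronglyMeasurable c (Measure.count : Measure (Fin 2 → ℤ)) :=
  (measurable_of_countable c).aestronglyMeasurable

lemma enorm_sq_eq_ofReal (z : ℂ) : ‖z‖ₑ ^ 2 = ENNReal.ofReal (‖z‖ ^ 2) := by
  rw [← ofReal_norm, ENNReal.ofReal_pow (norm_nonneg z)]

lemma hsENorm_sq (s : ℝ) (f : Torus2 → ℂ) :
    hsENorm s f ^ 2 =
      ∑' k, ENNReal.ofReal (japaneseSq k ^ s) * ‖torusFourierCoeff f k‖ₑ ^ 2 := by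
  have h := eLpNorm_nnreal_pow_eq_lintegral (p := 2) (μ := Measure.count)
    (f := fun k => ((japaneseSq k ^ (s / 2) : ℝ) : ℂ) * torusFourierCoeff f k) (by norm_num)
  rw [lintegral_count] at h
  simp only [NNReal.coe_ofNat, ENNReal.coe_ofNat, ENNReal.rpow_two] at h
  rw [hsENorm, h]
  congr 1; ext k
  rw [enorm_mul, mul_pow, enorm_sq_eq_ofReal (((japaneseSq k ^ (s / 2) : ℝ) : ℂ)),
    Complex.norm_real, Real.norm_eq_abs, sq_abs, ← Real.rpow_natCast,
    ← Real.rpow_mul (japaneseSq_pos k).le]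
  norm_num

lemma hsENorm_congr_ae {s : ℝ} {f g : Torus2 → ℂ} (h : f =ᵐ[volume] g) :
    hsENorm s f = hsENorm s g := by
  rw [hsENorm, hsENorm, torusFourierCoeff_congr_ae h]

lemma hsENorm_add_le (s : ℝ) {f g : Torus2 → ℂ} (hf : Integrable f) (hg : Integrable g) :
    hsENorm s (fun x => f x + g x) ≤ hsENorm s f + hsENorm s g := by
  unfold hsENorm
  simp only [torusFourierCoeff_add hf hg, mul_add]
  exact eLpNorm_add_le (aestronglyMeasurable_count _) (aestronglyMeasurable_count _) (by norm_num)

lemma hsENorm_const_mul (s : ℝ) (c : ℂ) (f : Torus2 → ℂ) :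
    hsENorm s (fun x => c * f x) = ‖c‖ₑ * hsENorm s f := by
  unfold hsENorm
  simp only [torusFourierCoeff_const_mul, mul_left_comm _ c]
  exact eLpNorm_const_smul c _ 2 _

lemma hsENorm_const (s : ℝ) (c : ℂ) : hsENorm s (fun _ => c) = ‖c‖ₑ := by
  have h : hsENorm s (fun _ => c) ^ 2 = ‖c‖ₑ ^ 2 := by
    rw [hsENorm_sq, tsum_eq_single 0]
    · simp [torusFourierCoeff_const, japaneseSq]
    · intro k hk
      simp [torusFourierCoeff_const, hk]
  exact (ENNReal.pow_right_strictMono two_ne_zero).injective h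

lemma hsENorm_conj (s : ℝ) (f : Torus2 → ℂ) :
    hsENorm s (fun x => conj (f x)) = hsENorm s f := by
  have h : hsENorm s (fun x => conj (f x)) ^ 2 = hsENorm s f ^ 2 := by
    rw [hsENorm_sq, hsENorm_sq, ← (Equiv.neg (Fin 2 → ℤ)).tsum_eq]
    congr 1; ext k
    simp only [Equiv.neg_apply, torusFourierCoeff_conj, neg_neg, japaneseSq_neg]
    rw [enorm_sq_eq_ofReal, enorm_sq_eq_ofReal, RCLike.norm_conj]
  exact (ENNReal.pow_right_strictMono two_ne_zero).injective h

lemma tsum_enorm_sq_torusFourierCoeff {f : Torus2 → ℂ} (hf : MemLp f 2 volume) :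
    ∑' k, ‖torusFourierCoeff f k‖ₑ ^ 2 =
      ENNReal.ofReal (((2 * Real.pi) ^ 2)⁻¹) * ∫⁻ x, ‖f x‖ₑ ^ 2 := by
  have h := hasSum_sq_torusFourierCoeff hf
  simp only [enorm_sq_eq_ofReal]
  rw [← ENNReal.ofReal_tsum_of_nonneg (fun k => sq_nonneg _) h.summable, h.tsum_eq,
    ENNReal.ofReal_mul (by positivity), ofReal_integral_eq_lintegral_ofReal
      ((memLp_two_iff_integrable_sq_norm hf.1).mp hf) (ae_of_all _ fun x => sq_nonneg _)]

lemma tsum_enorm_sq_le_hsENorm_sq {s : ℝ} (hs : 0 ≤ s) (f : Torus2 → ℂ) :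
    ∑' k, ‖torusFourierCoeff f k‖ₑ ^ 2 ≤ hsENorm s f ^ 2 := by
  rw [hsENorm_sq]
  refine ENNReal.tsum_le_tsum fun k => le_mul_of_one_le_left zero_le ?_
  rw [← ENNReal.ofReal_one]
  exact ENNReal.ofReal_le_ofReal (Real.one_le_rpow (one_le_japaneseSq k) hs)

/-! ### Trigonometric polynomials -/

/-- The frequencies `k` with `|k|_∞ ≤ n`. -/
noncomputable def freqBox (n : ℕ) : Finset (Fin 2 → ℤ) := Fintype.piFinset fun _ => Finset.Icc (-n : ℤ) n

lemma mem_freqBox {n : ℕ} {k : Fin 2 → ℤ} : k ∈ freqBox n ↔ ∀ i, |k i| ≤ n := by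
  simp [freqBox, Fintype.mem_piFinset, abs_le]

lemma card_freqBox (n : ℕ) : (freqBox n).card = (2 * n + 1) ^ 2 := by
  rw [freqBox, Fintype.card_piFinset]
  simp only [Int.card_Icc, Finset.prod_const, Finset.card_univ, Fintype.card_fin]
  congr 1; omega

lemma add_mem_freqBox {m n : ℕ} {k l : Fin 2 → ℤ} (hk : k ∈ freqBox m) (hl : l ∈ freqBox n) :
    k + l ∈ freqBox (m + n) := by
  rw [mem_freqBox] at *
  intro i
  rw [Pi.add_apply]; push_cast
  exact (abs_add_le _ _).trans (add_le_add (hk i) (hl i))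

/-- The trigonometric polynomials of degree at most `n` in each variable. -/
noncomputable def trigPoly (n : ℕ) : Submodule ℂ (Torus2 → ℂ) :=
  Submodule.span ℂ ((fun k => (torusMonomial k : Torus2 → ℂ)) '' freqBox n)

lemma monomial_mem_trigPoly {n : ℕ} {k : Fin 2 → ℤ} (hk : k ∈ freqBox n) :
    (torusMonomial k : Torus2 → ℂ) ∈ trigPoly n := Submodule.subset_span ⟨k, hk, rfl⟩

lemma trigPoly.continuous {n : ℕ} {P : Torus2 → ℂ} (hP : P ∈ trigPoly n) : Continuous P := by
  induction hP using Submodule.span_induction with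
  | mem x h => obtain ⟨k, -, rfl⟩ := h; exact (torusMonomial k).continuous
  | zero => exact continuous_const
  | add x y _ _ hx hy => exact hx.add hy
  | smul c x _ hx => exact hx.const_smul c

lemma trigPoly.mul {m n : ℕ} {P Q : Torus2 → ℂ} (hP : P ∈ trigPoly m) (hQ : Q ∈ trigPoly n) :
    (fun x => P x * Q x) ∈ trigPoly (m + n) := by
  induction hP using Submodule.span_induction with
  | mem P h =>
    obtain ⟨k, hk, rfl⟩ := h
    induction hQ using Submodule.span_induction with
    | mem Q h =>
      obtain ⟨l, hl, rfl⟩ := h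
      have := monomial_mem_trigPoly (add_mem_freqBox hk hl)
      convert this using 1
      ext x; exact (torusMonomial_add k l x).symm
    | zero => convert (trigPoly (m + n)).zero_mem using 1; ext x; simp
    | add x y _ _ hx hy =>
      convert add_mem hx hy using 1; ext z; simp [mul_add]
    | smul c x _ hx =>
      convert Submodule.smul_mem _ c hx using 1; ext z; simp [mul_left_comm]
  | zero => convert (trigPoly (m + n)).zero_mem using 1; ext x; simp
  | add x y _ _ hx hy =>
    convert add_mem hx hy using 1; ext z; simp [add_mul]
  | smul c x _ hx =>
    convert Submodule.smul_mem _ c hx using 1; ext z; simp [mul_assoc]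

lemma Continuous.integrable_torus {f : Torus2 → ℂ} (hf : Continuous f) : Integrable f :=
  hf.integrable_of_hasCompactSupport (HasCompactSupport.of_compactSpace f)

lemma trigPoly.coeff_eq_zero {n : ℕ} {P : Torus2 → ℂ} (hP : P ∈ trigPoly n) {k : Fin 2 → ℤ}
    (hk : k ∉ freqBox n) : torusFourierCoeff P k = 0 := by
  induction hP using Submodule.span_induction with
  | mem x h =>
    obtain ⟨l, hl, rfl⟩ := h
    rw [torusFourierCoeff_monomial, if_neg]
    rintro rfl; exact hk hl
  | zero => exact (torusFourierCoeff_const 0 k).trans (by simp)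
  | add x y hx' hy' hx hy =>
    have := torusFourierCoeff_add (trigPoly.continuous hx').integrable_torus
      (trigPoly.continuous hy').integrable_torus k
    rw [hx, hy, add_zero] at this; exact this
  | smul c x _ hx =>
    have := torusFourierCoeff_const_mul c x k
    rw [hx, mul_zero] at this; exact this

/-! ### De la Vallée Poussin approximation -/

/-- Parseval, since the Dirichlet kernel has one coefficient of modulus one for each frequency in
`S`. -/
lemma integral_sq_norm_dirichlet (S : Finset (Fin 2 → ℤ)) (x : Torus2) :
    ((2 * Real.pi) ^ 2)⁻¹ * ∫ y, ‖∑ k ∈ S, torusMonomial (-k) x * torusMonomial k y‖ ^ 2 =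
      S.card := by
  have hc : Continuous fun y => ∑ k ∈ S, torusMonomial (-k) x * torusMonomial k y := by fun_prop
  have hm : MemLp (fun y => ∑ k ∈ S, torusMonomial (-k) x * torusMonomial k y) 2 volume :=
    hc.memLp_of_hasCompactSupport (HasCompactSupport.of_compactSpace _)
  have h := hasSum_sq_torusFourierCoeff hm
  have hco : ∀ κ, torusFourierCoeff
      (fun y => ∑ k ∈ S, torusMonomial (-k) x * torusMonomial k y) κ =
      if κ ∈ S then torusMonomial (-κ) x else 0 := by
    intro κ
    rw [torusFourierCoeff_sum _ _ (fun k _ =>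
      (by fun_prop : Continuous fun y => torusMonomial (-k) x * torusMonomial k y).integrable_torus)]
    simp only [torusFourierCoeff_const_mul, torusFourierCoeff_monomial, mul_ite, mul_one, mul_zero]
    rw [Finset.sum_ite_eq]
  simp only [hco] at h
  have h2 : HasSum (fun k => ‖if k ∈ S then torusMonomial (-k) x else 0‖ ^ 2)
      (∑ k ∈ S, ‖if k ∈ S then torusMonomial (-k) x else 0‖ ^ 2) :=
    hasSum_sum_of_ne_finset_zero fun k hk => by simp [hk]
  rw [h.unique h2]
  rw [Finset.sum_congr rfl (g := fun _ => (1 : ℝ))]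
  · simp
  · intro k hk
    rw [if_pos hk, norm_torusMonomial_apply, one_pow]

/-- Bounded functions are approximated in `L²` as well as by their Fourier partial sums, by
trigonometric polynomials that obey comparable uniform bounds. -/
lemma exists_trigPoly_approx {f : Torus2 → ℂ} {a : ℝ} (hf : AEStronglyMeasurable f volume)
    (ha : ∀ᵐ x, ‖f x‖ ≤ a) (n : ℕ) :
    ∃ P ∈ trigPoly (3 * n), (∀ x, ‖P x‖ ≤ 5 / 2 * a) ∧
      ∀ k, ‖torusFourierCoeff (fun x => f x - P x) k‖ ≤
        if k ∈ freqBox n then 0 else ‖torusFourierCoeff f k‖ := by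
  have hfi : Integrable f := Integrable.of_bound hf a ha
  -- The kernel is the product of the Dirichlet kernels of `A` and `B`, divided by `|B|`. With `A`
  -- twice as wide as `B`, the multiplier equals one on `freqBox n`, while `|A| ≤ 4|B|` keeps the
  -- kernel bounded in `L¹`.
  set A := freqBox (2 * n) with hA
  set B := freqBox n with hB
  have hBpos : (0 : ℝ) < B.card := by rw [hB, card_freqBox]; positivity
  have hAB : (A.card : ℝ) ≤ 4 * B.card := by
    rw [hA, hB, card_freqBox, card_freqBox]; push_cast; nlinarith [n.cast_nonneg (α := ℝ)]
  have ha0 : 0 ≤ a := by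
    obtain ⟨x, hx⟩ := ha.exists
    exact (norm_nonneg _).trans hx
  refine ⟨fun x => (B.card : ℂ)⁻¹ * ∑ l ∈ B, ∑ k ∈ A,
    torusFourierCoeff f (k + l) * torusMonomial (k + l) x, ?_, ?_, ?_⟩
  · have : (fun x => (B.card : ℂ)⁻¹ * ∑ l ∈ B, ∑ k ∈ A,
        torusFourierCoeff f (k + l) * torusMonomial (k + l) x) =
        (B.card : ℂ)⁻¹ • ∑ l ∈ B, ∑ k ∈ A,
        torusFourierCoeff f (k + l) • (torusMonomial (k + l) : Torus2 → ℂ) := by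
      ext x; simp
    rw [this]
    refine Submodule.smul_mem _ _ (Submodule.sum_mem _ fun l hl => Submodule.sum_mem _ fun k hk =>
      Submodule.smul_mem _ _ (monomial_mem_trigPoly ?_))
    have := add_mem_freqBox hk hl
    rwa [show 2 * n + n = 3 * n by ring] at this
  · intro x
    set ΨA : Torus2 → ℂ := fun y => ∑ k ∈ A, torusMonomial (-k) x * torusMonomial k y with hΨA
    set ΨB : Torus2 → ℂ := fun y => ∑ k ∈ B, torusMonomial (-k) x * torusMonomial k y with hΨB
    have hcA : Continuous ΨA := by fun_prop
    have hcB : Continuous ΨB := by fun_prop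
    have hrep : ∑ l ∈ B, ∑ k ∈ A, torusFourierCoeff f (k + l) * torusMonomial (k + l) x =
        (((2 * Real.pi) ^ 2 : ℝ) : ℂ)⁻¹ * ∫ y, f y * (conj (ΨA y) * conj (ΨB y)) := by
      have : ∀ y, f y * (conj (ΨA y) * conj (ΨB y)) = ∑ l ∈ B, ∑ k ∈ A,
          (f y * torusMonomial (-(k + l)) y) * torusMonomial (k + l) x := by
        intro y
        simp only [hΨA, hΨB, map_sum, map_mul, ← torusMonomial_neg, neg_neg]
        rw [Finset.sum_mul_sum, Finset.sum_comm, Finset.mul_sum]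
        refine Finset.sum_congr rfl fun l _ => ?_
        rw [Finset.mul_sum]
        refine Finset.sum_congr rfl fun k _ => ?_
        rw [neg_add, torusMonomial_add, torusMonomial_add]; ring
      simp only [this]
      rw [integral_finsetSum _ fun l _ => integrable_finsetSum _ fun k _ =>
        (hfi.mul_torusMonomial _).mul_const _, Finset.mul_sum]
      refine Finset.sum_congr rfl fun l _ => ?_
      rw [integral_finsetSum _ fun k _ => (hfi.mul_torusMonomial _).mul_const _, Finset.mul_sum]
      refine Finset.sum_congr rfl fun k _ => ?_
      rw [integral_mul_const, torusFourierCoeff_eq]; ring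
    beta_reduce
    rw [hrep, norm_mul, norm_mul, norm_inv, norm_inv, Complex.norm_natCast, Complex.norm_real,
      Real.norm_eq_abs, abs_of_pos (by positivity), inv_mul_le_iff₀ hBpos]
    have hi : ∀ {g : Torus2 → ℂ}, Continuous g → Integrable fun y => ‖g y‖ ^ 2 := fun hg =>
      (by fun_prop : Continuous _).integrable_of_hasCompactSupport
        (HasCompactSupport.of_compactSpace _)
    have hle : ‖∫ y, f y * (conj (ΨA y) * conj (ΨB y))‖ ≤
        ∫ y, a / 2 * (‖ΨA y‖ ^ 2 + ‖ΨB y‖ ^ 2) := by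
      apply norm_integral_le_of_norm_le (((hi hcA).add (hi hcB)).const_mul _)
      filter_upwards [ha] with y hy
      rw [norm_mul, norm_mul, RCLike.norm_conj, RCLike.norm_conj]
      -- This splits the product kernel into two mean squares, computed by Parseval as `|A|` and
      -- `|B|`; the constant `5/2` is `(4 + 1)/2`.
      have h1 : ‖ΨA y‖ * ‖ΨB y‖ ≤ (‖ΨA y‖ ^ 2 + ‖ΨB y‖ ^ 2) / 2 := by
        nlinarith [sq_nonneg (‖ΨA y‖ - ‖ΨB y‖)]
      calc ‖f y‖ * (‖ΨA y‖ * ‖ΨB y‖) ≤ a * ((‖ΨA y‖ ^ 2 + ‖ΨB y‖ ^ 2) / 2) := by gcongr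
        _ = a / 2 * (‖ΨA y‖ ^ 2 + ‖ΨB y‖ ^ 2) := by ring
    rw [integral_const_mul, integral_add (hi hcA) (hi hcB)] at hle
    have e1 := integral_sq_norm_dirichlet A x
    have e2 := integral_sq_norm_dirichlet B x
    calc ((2 * Real.pi) ^ 2)⁻¹ * ‖∫ y, f y * (conj (ΨA y) * conj (ΨB y))‖
        ≤ ((2 * Real.pi) ^ 2)⁻¹ * (a / 2 * ((∫ y, ‖ΨA y‖ ^ 2) + ∫ y, ‖ΨB y‖ ^ 2)) := by gcongr
      _ = a / 2 * (((2 * Real.pi) ^ 2)⁻¹ * (∫ y, ‖ΨA y‖ ^ 2) +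
          ((2 * Real.pi) ^ 2)⁻¹ * ∫ y, ‖ΨB y‖ ^ 2) := by ring
      _ = a / 2 * (A.card + B.card) := by rw [e1, e2]
      _ ≤ a / 2 * (4 * B.card + B.card) := by gcongr
      _ = _ := by ring
  · intro κ
    have hPc : ∀ k l, Continuous fun x => torusFourierCoeff f (k + l) * torusMonomial (k + l) x :=
      fun k l => by fun_prop
    rw [torusFourierCoeff_sub hfi (by fun_prop : Continuous fun x => (B.card : ℂ)⁻¹ * ∑ l ∈ B,
      ∑ k ∈ A, torusFourierCoeff f (k + l) * torusMonomial (k + l) x).integrable_torus,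
      torusFourierCoeff_const_mul, torusFourierCoeff_sum _ _ (fun l _ =>
        (continuous_finsetSum _ fun k _ => hPc k l).integrable_torus)]
    have hin : ∀ l ∈ B, torusFourierCoeff (fun x => ∑ k ∈ A,
        torusFourierCoeff f (k + l) * torusMonomial (k + l) x) κ =
        if κ - l ∈ A then torusFourierCoeff f κ else 0 := by
      intro l _
      rw [torusFourierCoeff_sum _ _ (fun k _ => (hPc k l).integrable_torus)]
      simp only [torusFourierCoeff_const_mul, torusFourierCoeff_monomial]
      rw [← Finset.sum_ite_eq A (κ - l) (fun _ => torusFourierCoeff f κ)]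
      refine Finset.sum_congr rfl fun k _ => ?_
      by_cases h : κ = k + l
      · subst h; simp
      · rw [if_neg h, if_neg (fun h' => h (by rw [← h']; simp)), mul_zero]
    rw [Finset.sum_congr rfl hin]
    split_ifs with hκ
    · have : ∀ l ∈ B, (if κ - l ∈ A then torusFourierCoeff f κ else 0) = torusFourierCoeff f κ := by
        intro l hl
        rw [if_pos]
        have hl' : -l ∈ freqBox n := by
          rw [hB, mem_freqBox] at hl
          rw [mem_freqBox]; simpa using hl
        have := add_mem_freqBox hκ hl'
        rwa [← sub_eq_add_neg, show n + n = 2 * n by ring] at this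
      rw [Finset.sum_congr rfl this, Finset.sum_const, nsmul_eq_mul, inv_mul_cancel_left₀, sub_self,
        norm_zero]
      exact_mod_cast hBpos.ne'
    -- Off the inner box the multiplier is the fraction `N/|B|` of those `l ∈ B` with `κ - l ∈ A`.
    -- It lies in `[0, 1]`, so the error never exceeds the original coefficient.
    · rw [Finset.sum_ite, Finset.sum_const, Finset.sum_const_zero, add_zero, nsmul_eq_mul]
      set N := (B.filter fun l => κ - l ∈ A).card with hN
      have hNB : (N : ℝ) ≤ B.card := by exact_mod_cast Finset.card_filter_le _ _
      have : torusFourierCoeff f κ - (B.card : ℂ)⁻¹ * (N * torusFourierCoeff f κ) =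
          ((1 - N / B.card : ℝ) : ℂ) * torusFourierCoeff f κ := by
        push_cast; ring
      rw [this, norm_mul, Complex.norm_real, Real.norm_eq_abs]
      apply mul_le_of_le_one_left (norm_nonneg _)
      have h1 : (N : ℝ) / B.card ≤ 1 := (div_le_one hBpos).mpr hNB
      have h2 : 0 ≤ (N : ℝ) / B.card := by positivity
      rw [abs_le]; constructor <;> linarith

/-! ### Tame product estimate -/

/-- The square mass of the Fourier coefficients outside `freqBox n`. -/
noncomputable def fourierTail (n : ℕ) (f : Torus2 → ℂ) : ℝ≥0∞ :=
  ∑' k, if k ∈ freqBox n then 0 else ‖torusFourierCoeff f k‖ₑ ^ 2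

lemma fourierTail_le (n : ℕ) (f : Torus2 → ℂ) :
    fourierTail n f ≤ ∑' k, ‖torusFourierCoeff f k‖ₑ ^ 2 :=
  ENNReal.tsum_le_tsum fun k => by split_ifs <;> simp

lemma memLp_two_of_bound {f : Torus2 → ℂ} {a : ℝ} (hf : AEStronglyMeasurable f volume)
    (ha : ∀ᵐ x, ‖f x‖ ≤ a) : MemLp f 2 volume := MemLp.of_bound hf a ha

lemma lintegral_approx_le_fourierTail {f P : Torus2 → ℂ} {n : ℕ} (hf : MemLp f 2 volume)
    (hP : Continuous P)
    (h : ∀ k, ‖torusFourierCoeff (fun x => f x - P x) k‖ ≤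
      if k ∈ freqBox n then 0 else ‖torusFourierCoeff f k‖) :
    ENNReal.ofReal (((2 * Real.pi) ^ 2)⁻¹) * ∫⁻ x, ‖f x - P x‖ₑ ^ 2 ≤ fourierTail n f := by
  have hP2 : MemLp P 2 volume := hP.memLp_of_hasCompactSupport (HasCompactSupport.of_compactSpace _)
  have h0 : ∑' k, ‖torusFourierCoeff (fun x => f x - P x) k‖ₑ ^ 2 =
      ENNReal.ofReal (((2 * Real.pi) ^ 2)⁻¹) * ∫⁻ x, ‖f x - P x‖ₑ ^ 2 :=
    tsum_enorm_sq_torusFourierCoeff (hf.sub hP2)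
  rw [← h0]
  refine ENNReal.tsum_le_tsum fun k => ?_
  have := h k
  rw [enorm_sq_eq_ofReal, enorm_sq_eq_ofReal]
  split_ifs at this ⊢ with hk
  · rw [le_antisymm this (norm_nonneg _)]; simp
  · gcongr

/-- Subtracting `PQ`, which has no frequency outside `freqBox (6 * n)`, leaves the tail unchanged.
The remainder `f(g - Q) + (f - P)Q` is estimated in `L²`, with the sup norm on `f` and on `Q`. -/
lemma fourierTail_mul_le {f g : Torus2 → ℂ} {a b : ℝ} (hf : AEStronglyMeasurable f volume)
    (hg : AEStronglyMeasurable g volume) (ha : ∀ᵐ x, ‖f x‖ ≤ a) (hb : ∀ᵐ x, ‖g x‖ ≤ b) (n : ℕ) :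
    fourierTail (6 * n) (fun x => f x * g x) ≤
      ENNReal.ofReal (13 * a ^ 2) * fourierTail n g +
        ENNReal.ofReal (13 * b ^ 2) * fourierTail n f := by
  obtain ⟨P, hP, -, hPc⟩ := exists_trigPoly_approx hf ha n
  obtain ⟨Q, hQ, hQb, hQc⟩ := exists_trigPoly_approx hg hb n
  have cP := trigPoly.continuous hP
  have cQ := trigPoly.continuous hQ
  have hPQ := trigPoly.mul hP hQ
  rw [show 3 * n + 3 * n = 6 * n by ring] at hPQ
  have hfm := memLp_two_of_bound hf ha
  have hgm := memLp_two_of_bound hg hb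
  have hfg : MemLp (fun x => f x * g x) 2 volume := by
    apply memLp_two_of_bound (a := a * b) (hf.mul hg)
    filter_upwards [ha, hb] with x h1 h2
    rw [Pi.mul_apply, norm_mul]
    have := norm_nonneg (f x)
    gcongr
    linarith
  have cPQ : Continuous fun x => P x * Q x := cP.mul cQ
  have hPQ2 : MemLp (fun x => P x * Q x) 2 volume :=
    cPQ.memLp_of_hasCompactSupport (HasCompactSupport.of_compactSpace _)
  have h1 : fourierTail (6 * n) (fun x => f x * g x) =
      fourierTail (6 * n) (fun x => f x * g x - P x * Q x) := by
    unfold fourierTail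
    congr 1; ext k
    split_ifs with hk
    · rfl
    · rw [torusFourierCoeff_sub (hfg.integrable (by norm_num)) cPQ.integrable_torus,
        trigPoly.coeff_eq_zero hPQ hk, sub_zero]
  have hpt : ∀ᵐ x, ‖f x * g x - P x * Q x‖ₑ ^ 2 ≤
      ENNReal.ofReal (13 * a ^ 2) * ‖g x - Q x‖ₑ ^ 2 +
        ENNReal.ofReal (13 * b ^ 2) * ‖f x - P x‖ₑ ^ 2 := by
    filter_upwards [ha] with x hx
    simp only [enorm_sq_eq_ofReal]
    rw [← ENNReal.ofReal_mul (by positivity), ← ENNReal.ofReal_mul (by positivity),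
      ← ENNReal.ofReal_add (by positivity) (by positivity)]
    apply ENNReal.ofReal_le_ofReal
    have e : f x * g x - P x * Q x = f x * (g x - Q x) + (f x - P x) * Q x := by ring
    have hle : ‖f x * g x - P x * Q x‖ ≤ a * ‖g x - Q x‖ + 5 / 2 * b * ‖f x - P x‖ := by
      rw [e]
      refine (norm_add_le _ _).trans ?_
      rw [norm_mul, norm_mul, mul_comm ‖f x - P x‖]
      gcongr
      exact hQb x
    calc ‖f x * g x - P x * Q x‖ ^ 2 ≤ (a * ‖g x - Q x‖ + 5 / 2 * b * ‖f x - P x‖) ^ 2 := by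
          gcongr
      _ ≤ 2 * (a * ‖g x - Q x‖) ^ 2 + 2 * (5 / 2 * b * ‖f x - P x‖) ^ 2 := by
          nlinarith [sq_nonneg (a * ‖g x - Q x‖ - 5 / 2 * b * ‖f x - P x‖)]
      -- The two coefficients are `2` and `2·(5/2)² = 25/2`; both are rounded up to `13`.
      _ ≤ _ := by
          nlinarith [sq_nonneg (a * ‖g x - Q x‖), sq_nonneg (b * ‖f x - P x‖)]
  calc fourierTail (6 * n) (fun x => f x * g x)
      ≤ ∑' k, ‖torusFourierCoeff (fun x => f x * g x - P x * Q x) k‖ₑ ^ 2 := by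
        rw [h1]; exact fourierTail_le _ _
    _ = ENNReal.ofReal (((2 * Real.pi) ^ 2)⁻¹) * ∫⁻ x, ‖f x * g x - P x * Q x‖ₑ ^ 2 :=
        tsum_enorm_sq_torusFourierCoeff (hfg.sub hPQ2)
    _ ≤ ENNReal.ofReal (((2 * Real.pi) ^ 2)⁻¹) *
        ∫⁻ x, (ENNReal.ofReal (13 * a ^ 2) * ‖g x - Q x‖ₑ ^ 2 +
        ENNReal.ofReal (13 * b ^ 2) * ‖f x - P x‖ₑ ^ 2) := by
        exact mul_le_mul_right (lintegral_mono_ae hpt) _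
    _ = ENNReal.ofReal (13 * a ^ 2) *
          (ENNReal.ofReal (((2 * Real.pi) ^ 2)⁻¹) * ∫⁻ x, ‖g x - Q x‖ₑ ^ 2) +
        ENNReal.ofReal (13 * b ^ 2) *
          (ENNReal.ofReal (((2 * Real.pi) ^ 2)⁻¹) * ∫⁻ x, ‖f x - P x‖ₑ ^ 2) := by
        have m1 : AEMeasurable fun x => ‖g x - Q x‖ₑ ^ 2 :=
          ((hg.sub cQ.aestronglyMeasurable).enorm).pow_const 2
        have m2 : AEMeasurable fun x => ‖f x - P x‖ₑ ^ 2 :=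
          ((hf.sub cP.aestronglyMeasurable).enorm).pow_const 2
        rw [lintegral_add_left' (m1.const_mul _), lintegral_const_mul'' _ m1,
          lintegral_const_mul'' _ m2]
        ring
    _ ≤ _ := by
        gcongr
        · exact lintegral_approx_le_fourierTail hgm cQ hQc
        · exact lintegral_approx_le_fourierTail hfm cP hPc

/-- The maximum norm of a frequency. -/
def freqSup (k : Fin 2 → ℤ) : ℕ := max (k 0).natAbs (k 1).natAbs

lemma notMem_freqBox {n : ℕ} {k : Fin 2 → ℤ} : k ∉ freqBox n ↔ n < freqSup k := by
  rw [mem_freqBox, ← not_le, not_iff_not, freqSup, Fin.forall_fin_two, Int.abs_eq_natAbs, Int.abs_eq_natAbs]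
  omega

lemma freqSup_sq_le (k : Fin 2 → ℤ) : (freqSup k : ℝ) ^ 2 ≤ japaneseSq k := by
  rw [japaneseSq, Fin.sum_univ_two, freqSup]
  have h : ∀ z : ℤ, ((z.natAbs : ℕ) : ℝ) ^ 2 = (z : ℝ) ^ 2 := fun z => by
    rw [Nat.cast_natAbs, Int.cast_abs, sq_abs]
  rcases max_choice (k 0).natAbs (k 1).natAbs with h1 | h1 <;> rw [h1, h] <;>
    nlinarith [sq_nonneg (k 0 : ℝ), sq_nonneg (k 1 : ℝ)]

lemma japaneseSq_le_freqSup (k : Fin 2 → ℤ) : japaneseSq k ≤ 1 + 2 * (freqSup k : ℝ) ^ 2 := by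
  rw [japaneseSq, Fin.sum_univ_two, freqSup]
  have h : ∀ z : ℤ, (z : ℝ) ^ 2 = ((z.natAbs : ℕ) : ℝ) ^ 2 := fun z => by
    rw [Nat.cast_natAbs, Int.cast_abs, sq_abs]
  rw [h, h, Nat.cast_max]
  have h0 := le_max_left ((k 0).natAbs : ℝ) ((k 1).natAbs : ℝ)
  have h1 := le_max_right ((k 0).natAbs : ℝ) ((k 1).natAbs : ℝ)
  have := pow_le_pow_left₀ (by positivity) h0 2
  have := pow_le_pow_left₀ (by positivity) h1 2
  linarith

lemma four_rpow_pow (s : ℝ) (j : ℕ) : ((4 : ℝ) ^ s) ^ j = ((2 ^ j : ℝ) ^ 2) ^ s := by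
  rw [← Real.rpow_natCast, ← Real.rpow_mul (by norm_num), mul_comm, Real.rpow_mul (by norm_num),
    Real.rpow_natCast, ← pow_mul, mul_comm j 2, pow_mul]
  norm_num

/-- The dyadic weight `∑_j 4^{sj} 1_{c 2^j < |k|_∞}`. -/
noncomputable def dyadicWeight (s : ℝ) (c : ℕ) (k : Fin 2 → ℤ) : ℝ≥0∞ :=
  ∑' j : ℕ, if k ∈ freqBox (c * 2 ^ j) then 0 else ENNReal.ofReal (((4 : ℝ) ^ s) ^ j)

/-- Only `j` with `2^j < |k|_∞` contribute. As `s > 0`, this geometric sum is comparable to its last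
term, which is at most `⟨k⟩^{2s}`. -/
lemma dyadicWeight_le {s : ℝ} (hs : 0 < s) (k : Fin 2 → ℤ) :
    dyadicWeight s 1 k ≤ ENNReal.ofReal ((4 : ℝ) ^ s / ((4 : ℝ) ^ s - 1)) *
      ENNReal.ofReal (japaneseSq k ^ s) := by
  set q : ℝ := (4 : ℝ) ^ s with hq
  have hq1 : 1 < q := Real.one_lt_rpow (by norm_num) hs
  set L := Nat.clog 2 (freqSup k) with hL
  have hJ := one_le_japaneseSq k
  have hle : dyadicWeight s 1 k ≤ ∑ j ∈ Finset.range L, ENNReal.ofReal (q ^ j) := by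
    rw [dyadicWeight, tsum_eq_sum (s := Finset.range L)]
    · exact Finset.sum_le_sum fun j _ => by split_ifs; exacts [zero_le, le_rfl]
    · intro j hj
      rw [if_pos]
      by_contra h
      rw [notMem_freqBox, one_mul] at h
      exact hj (Finset.mem_range.mpr ((Nat.lt_clog_iff_pow_lt (by norm_num)).mpr h))
  refine hle.trans ?_
  rw [← ENNReal.ofReal_sum_of_nonneg (fun j _ => by positivity),
    ← ENNReal.ofReal_mul (div_nonneg (by positivity) (by linarith))]
  apply ENNReal.ofReal_le_ofReal
  rw [geom_sum_eq hq1.ne', div_mul_eq_mul_div]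
  have hq1' : 0 < q - 1 := by linarith
  apply div_le_div_of_nonneg_right _ hq1'.le
  rcases Nat.eq_zero_or_pos L with h0 | h0
  · rw [h0, pow_zero, sub_self]; positivity
  · obtain ⟨l, hl⟩ : ∃ l, L = l + 1 := ⟨L - 1, by omega⟩
    have hlt : 2 ^ l < freqSup k := (Nat.lt_clog_iff_pow_lt (by norm_num)).mp (by omega)
    have hlt' : (2 ^ l : ℝ) ≤ freqSup k := by exact_mod_cast hlt.le
    have : q ^ l ≤ japaneseSq k ^ s := by
      rw [hq, four_rpow_pow]
      apply Real.rpow_le_rpow (by positivity) _ hs.le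
      exact (pow_le_pow_left₀ (by positivity) hlt' 2).trans (freqSup_sq_le k)
    rw [hl, pow_succ]
    nlinarith

/-- A single term of the weight suffices: the largest `j` with `6·2^j < |k|_∞` has `|k|_∞ ≤ 12·2^j`,
so `⟨k⟩² ≤ 3|k|_∞² ≤ 432·4^j`. The summand `1` covers the frequencies `|k|_∞ ≤ 6`. -/
lemma le_dyadicWeight {s : ℝ} (hs : 0 < s) (k : Fin 2 → ℤ) :
    ENNReal.ofReal (japaneseSq k ^ s) ≤
      ENNReal.ofReal ((432 : ℝ) ^ s) * (1 + dyadicWeight s 6 k) := by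
  have hJ := japaneseSq_le_freqSup k
  have hJ0 := (japaneseSq_pos k).le
  rcases le_or_gt (freqSup k) 6 with h | h
  · refine le_trans ?_ (mul_le_mul_right (le_self_add) _)
    rw [mul_one]
    apply ENNReal.ofReal_le_ofReal
    apply Real.rpow_le_rpow hJ0 _ hs.le
    have : (freqSup k : ℝ) ≤ 6 := by exact_mod_cast h
    nlinarith [(freqSup k).cast_nonneg (α := ℝ)]
  · obtain ⟨j, hj1, hj2⟩ := exists_nat_pow_near (x := (freqSup k - 1) / 6) (y := 2)
      (by omega) (by norm_num)
    have h1 : 6 * 2 ^ j < freqSup k := by omega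
    have h2 : freqSup k ≤ 12 * 2 ^ j := by rw [pow_succ] at hj2; omega
    have h3 : ENNReal.ofReal (((4 : ℝ) ^ s) ^ j) ≤ dyadicWeight s 6 k := by
      refine le_trans ?_ (ENNReal.le_tsum j)
      rw [if_neg (notMem_freqBox.mpr h1)]
    refine le_trans ?_ (mul_le_mul_right (h3.trans le_add_self) _)
    rw [← ENNReal.ofReal_mul (by positivity)]
    apply ENNReal.ofReal_le_ofReal
    rw [four_rpow_pow, ← Real.mul_rpow (by norm_num) (by positivity)]
    apply Real.rpow_le_rpow hJ0 _ hs.le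
    have h2' : (freqSup k : ℝ) ≤ 12 * 2 ^ j := by exact_mod_cast h2
    have h5 : (1 : ℝ) ≤ 2 ^ j := one_le_pow₀ (by norm_num)
    nlinarith [(freqSup k).cast_nonneg (α := ℝ)]

/-- Interchanging the sums turns tail bounds at dyadic scales into a weighted `ℓ²` bound. -/
lemma tsum_fourierTail (s : ℝ) (c : ℕ) (f : Torus2 → ℂ) :
    ∑' j : ℕ, ENNReal.ofReal (((4 : ℝ) ^ s) ^ j) * fourierTail (c * 2 ^ j) f =
      ∑' k, dyadicWeight s c k * ‖torusFourierCoeff f k‖ₑ ^ 2 := by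
  simp only [fourierTail, dyadicWeight, ← ENNReal.tsum_mul_left, ← ENNReal.tsum_mul_right]
  rw [ENNReal.tsum_comm]
  congr 1; ext k; congr 1; ext j
  split_ifs <;> simp

/-- **Tame product estimate** in `H^s`, `s > 0`. -/
lemma exists_hsENorm_mul_le {s : ℝ} (hs : 0 < s) :
    ∃ C : ℝ, 1 ≤ C ∧ ∀ (f g : Torus2 → ℂ) (a b : ℝ), AEStronglyMeasurable f volume →
      AEStronglyMeasurable g volume → (∀ᵐ x, ‖f x‖ ≤ a) → (∀ᵐ x, ‖g x‖ ≤ b) →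
      hsENorm s (fun x => f x * g x) ≤
        ENNReal.ofReal C * (ENNReal.ofReal a * hsENorm s g + ENNReal.ofReal b * hsENorm s f) := by
  set C1 : ℝ := (4 : ℝ) ^ s / ((4 : ℝ) ^ s - 1) with hC1
  set C2 : ℝ := (432 : ℝ) ^ s with hC2
  have hq1 : 1 < (4 : ℝ) ^ s := Real.one_lt_rpow (by norm_num) hs
  have hC1p : 0 < C1 := div_pos (by linarith) (by linarith)
  have hC2p : 1 ≤ C2 := Real.one_le_rpow (by norm_num) hs.le
  refine ⟨C2 * (1 + 13 * C1), by nlinarith, fun f g a b hf hg ha hb => ?_⟩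
  have ha0 : 0 ≤ a := by
    obtain ⟨x, hx⟩ := ha.exists
    exact (norm_nonneg _).trans hx
  have hb0 : 0 ≤ b := by
    obtain ⟨x, hx⟩ := hb.exists
    exact (norm_nonneg _).trans hx
  set X := ENNReal.ofReal (a ^ 2) * hsENorm s g ^ 2 with hX
  set Y := ENNReal.ofReal (b ^ 2) * hsENorm s f ^ 2 with hY
  have hup : ∀ h : Torus2 → ℂ, ∑' k, dyadicWeight s 1 k * ‖torusFourierCoeff h k‖ₑ ^ 2 ≤
      ENNReal.ofReal C1 * hsENorm s h ^ 2 := by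
    intro h
    rw [hsENorm_sq, ← ENNReal.tsum_mul_left]
    refine ENNReal.tsum_le_tsum fun k => ?_
    rw [← mul_assoc]
    gcongr
    exact dyadicWeight_le hs k
  -- The tails say nothing about low frequencies; the plain `L²` bound `‖fg‖ ≤ a‖g‖` handles them.
  have hL2 : ∑' k, ‖torusFourierCoeff (fun x => f x * g x) k‖ₑ ^ 2 ≤ X := by
    have hm : MemLp (fun x => f x * g x) 2 volume := by
      apply memLp_two_of_bound (a := a * b) (hf.mul hg)
      filter_upwards [ha, hb] with x h1 h2
      rw [Pi.mul_apply, norm_mul]; gcongr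
    rw [tsum_enorm_sq_torusFourierCoeff hm]
    calc ENNReal.ofReal (((2 * Real.pi) ^ 2)⁻¹) * ∫⁻ x, ‖f x * g x‖ₑ ^ 2
        ≤ ENNReal.ofReal (((2 * Real.pi) ^ 2)⁻¹) *
          ∫⁻ x, ENNReal.ofReal (a ^ 2) * ‖g x‖ₑ ^ 2 := by
          refine mul_le_mul_right (lintegral_mono_ae ?_) _
          filter_upwards [ha] with x hx
          rw [enorm_sq_eq_ofReal, enorm_sq_eq_ofReal, ← ENNReal.ofReal_mul (by positivity),
            norm_mul, mul_pow]
          gcongr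
      _ = ENNReal.ofReal (a ^ 2) * ∑' k, ‖torusFourierCoeff g k‖ₑ ^ 2 := by
          rw [lintegral_const_mul'' _ (hg.enorm.pow_const 2),
            tsum_enorm_sq_torusFourierCoeff (memLp_two_of_bound hg hb)]
          ring
      _ ≤ X := by
          rw [hX]; gcongr; exact tsum_enorm_sq_le_hsENorm_sq hs.le g
  have hmain : hsENorm s (fun x => f x * g x) ^ 2 ≤
      ENNReal.ofReal (C2 * (1 + 13 * C1)) * (X + Y) := by
    calc hsENorm s (fun x => f x * g x) ^ 2
        ≤ ∑' k, ENNReal.ofReal C2 * (‖torusFourierCoeff (fun x => f x * g x) k‖ₑ ^ 2 +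
          dyadicWeight s 6 k * ‖torusFourierCoeff (fun x => f x * g x) k‖ₑ ^ 2) := by
          rw [hsENorm_sq]
          refine ENNReal.tsum_le_tsum fun k => ?_
          refine (mul_le_mul_left (le_dyadicWeight hs k) _).trans (le_of_eq ?_)
          ring
      _ = ENNReal.ofReal C2 * (∑' k, ‖torusFourierCoeff (fun x => f x * g x) k‖ₑ ^ 2 +
          ∑' j : ℕ, ENNReal.ofReal (((4 : ℝ) ^ s) ^ j) *
            fourierTail (6 * 2 ^ j) (fun x => f x * g x)) := by
          rw [ENNReal.tsum_mul_left, ENNReal.tsum_add, tsum_fourierTail]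
      _ ≤ ENNReal.ofReal C2 * (X + ∑' j : ℕ, ENNReal.ofReal (((4 : ℝ) ^ s) ^ j) *
            (ENNReal.ofReal (13 * a ^ 2) * fourierTail (1 * 2 ^ j) g +
              ENNReal.ofReal (13 * b ^ 2) * fourierTail (1 * 2 ^ j) f)) := by
          gcongr with j
          rw [one_mul]
          exact fourierTail_mul_le hf hg ha hb _
      _ = ENNReal.ofReal C2 * (X +
            (ENNReal.ofReal (13 * a ^ 2) *
              ∑' k, dyadicWeight s 1 k * ‖torusFourierCoeff g k‖ₑ ^ 2 +
            ENNReal.ofReal (13 * b ^ 2) *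
              ∑' k, dyadicWeight s 1 k * ‖torusFourierCoeff f k‖ₑ ^ 2)) := by
          rw [← tsum_fourierTail, ← tsum_fourierTail, ← ENNReal.tsum_mul_left,
            ← ENNReal.tsum_mul_left, ← ENNReal.tsum_add]
          congr 3; ext j; ring
      _ ≤ ENNReal.ofReal C2 * (X + (ENNReal.ofReal (13 * a ^ 2) *
              (ENNReal.ofReal C1 * hsENorm s g ^ 2) +
            ENNReal.ofReal (13 * b ^ 2) * (ENNReal.ofReal C1 * hsENorm s f ^ 2))) := by
          gcongr <;> exact hup _
      _ = ENNReal.ofReal C2 * (X + ENNReal.ofReal (13 * C1) * (X + Y)) := by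
          rw [hX, hY, ENNReal.ofReal_mul (by norm_num : (0 : ℝ) ≤ 13),
            ENNReal.ofReal_mul (by norm_num : (0 : ℝ) ≤ 13),
            ENNReal.ofReal_mul (by norm_num : (0 : ℝ) ≤ 13)]
          ring
      _ ≤ ENNReal.ofReal C2 * ((X + Y) + ENNReal.ofReal (13 * C1) * (X + Y)) := by
          gcongr; exact le_self_add
      _ = _ := by
          rw [ENNReal.ofReal_mul (q := 1 + 13 * C1) (by positivity),
            ENNReal.ofReal_add (by norm_num) (by positivity), ENNReal.ofReal_one]
          ring
  have hC : 1 ≤ C2 * (1 + 13 * C1) := by nlinarith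
  -- In squared form it suffices that the constant is at most its square, being at least one, and
  -- that `X + Y` is at most the square of the sum.
  rw [← ENNReal.pow_le_pow_left_iff two_ne_zero]
  refine hmain.trans ?_
  rw [mul_pow]
  gcongr
  · rw [sq]
    refine le_mul_of_one_le_left zero_le ?_
    rw [← ENNReal.ofReal_one]
    exact ENNReal.ofReal_le_ofReal hC
  · rw [hX, hY, ENNReal.ofReal_pow ha0, ENNReal.ofReal_pow hb0, ← mul_pow, ← mul_pow, add_sq,
      add_right_comm]
    exact le_self_add

/-! ### Composition with analytic functions -/

lemma MeasureTheory.AEStronglyMeasurable.integrable_of_bound_torus {f : Torus2 → ℂ} {a : ℝ}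
    (hf : AEStronglyMeasurable f volume) (ha : ∀ᵐ x, ‖f x‖ ≤ a) : Integrable f :=
  Integrable.of_bound hf a ha

lemma ae_norm_pow_le {w : Torus2 → ℂ} {r : ℝ} (hr : ∀ᵐ x, ‖w x‖ ≤ r) (n : ℕ) :
    ∀ᵐ x, ‖w x ^ n‖ ≤ r ^ n := by
  filter_upwards [hr] with x hx
  rw [norm_pow]; gcongr

/-- The `H^s` norm of the powers of a function bounded by `r` is `O(n^A r^n)`. -/
lemma exists_hsENorm_pow_le {s : ℝ} (hs : 0 < s) :
    ∃ A : ℕ, ∀ (w : Torus2 → ℂ) (r : ℝ), AEStronglyMeasurable w volume → (∀ᵐ x, ‖w x‖ ≤ r) →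
      ∀ n : ℕ, 1 ≤ n →
        hsENorm s (fun x => w x ^ n) ≤ ENNReal.ofReal (n ^ A * r ^ (n - 1)) * hsENorm s w := by
  obtain ⟨C, hC1, hC⟩ := exists_hsENorm_mul_le hs
  -- With `2C(2/3)^A ≤ 1`, the factor `2C` from one application of the product estimate is paid for
  -- by the decrease of `n^A` when `n` drops to at most `2n/3`.
  obtain ⟨A, hA⟩ := exists_pow_lt_of_lt_one (show 0 < 1 / (2 * C) by positivity)
    (show (2 / 3 : ℝ) < 1 by norm_num)
  have hA' : 2 * C * (2 / 3 : ℝ) ^ A ≤ 1 := by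
    rw [lt_div_iff₀ (by positivity)] at hA
    linarith
  refine ⟨A, fun w r hw hr n => ?_⟩
  have hr0 : 0 ≤ r := by
    obtain ⟨x, hx⟩ := hr.exists
    exact (norm_nonneg _).trans hx
  induction n using Nat.strong_induction_on with
  | _ n ih =>
    intro hn
    rcases hn.eq_or_lt with rfl | hn2
    · simp
    -- Halving needs only logarithmically many products. Peeling off one factor at a time would cost
    -- an exponential constant and shrink the usable radius of convergence. The ratio `2/3` is
    -- attained at `n = 3`.
    obtain ⟨p, q, hp, hq, hpq, hp3, hq3⟩ :
        ∃ p q, 1 ≤ p ∧ 1 ≤ q ∧ n = p + q ∧ 3 * p ≤ 2 * n ∧ 3 * q ≤ 2 * n :=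
      ⟨n / 2, n - n / 2, by omega, by omega, by omega, by omega, by omega⟩
    have ihp := ih p (by omega) hp
    have ihq := ih q (by omega) hq
    have hmul := hC (fun x => w x ^ p) (fun x => w x ^ q) (r ^ p) (r ^ q) (hw.pow p) (hw.pow q)
      (ae_norm_pow_le hr p) (ae_norm_pow_le hr q)
    have hgrow : ∀ j : ℕ, 3 * j ≤ 2 * n → (j : ℝ) ^ A ≤ (2 / 3) ^ A * n ^ A := by
      intro j hj
      rw [← mul_pow]
      have : (3 * j : ℝ) ≤ 2 * n := by exact_mod_cast hj
      gcongr
      linarith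
    calc hsENorm s (fun x => w x ^ n) = hsENorm s (fun x => w x ^ p * w x ^ q) := by
          simp only [hpq, pow_add]
      _ ≤ _ := hmul
      _ ≤ ENNReal.ofReal C * (ENNReal.ofReal (r ^ p) *
            (ENNReal.ofReal (q ^ A * r ^ (q - 1)) * hsENorm s w) + ENNReal.ofReal (r ^ q) *
            (ENNReal.ofReal (p ^ A * r ^ (p - 1)) * hsENorm s w)) := by gcongr
      _ = ENNReal.ofReal (C * (r ^ p * (q ^ A * r ^ (q - 1)) + r ^ q * (p ^ A * r ^ (p - 1)))) *
            hsENorm s w := by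
          rw [ENNReal.ofReal_mul (p := C) (by positivity), ENNReal.ofReal_add (by positivity)
            (by positivity), ENNReal.ofReal_mul (p := r ^ p) (by positivity),
            ENNReal.ofReal_mul (p := r ^ q) (by positivity)]
          ring
      _ ≤ _ := by
          refine mul_le_mul_left (ENNReal.ofReal_le_ofReal ?_) _
          have e1 : r ^ p * (q ^ A * r ^ (q - 1)) = q ^ A * r ^ (n - 1) := by
            rw [mul_left_comm, ← pow_add]; congr 2; omega
          have e2 : r ^ q * (p ^ A * r ^ (p - 1)) = p ^ A * r ^ (n - 1) := by
            rw [mul_left_comm, ← pow_add]; congr 2; omega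
          rw [e1, e2, ← add_mul, ← mul_assoc]
          gcongr
          have h1 := hgrow p hp3
          have h2 := hgrow q hq3
          calc C * ((q : ℝ) ^ A + p ^ A) ≤ C * ((2 / 3) ^ A * n ^ A + (2 / 3) ^ A * n ^ A) := by
                gcongr
            _ = (2 * C * (2 / 3) ^ A) * n ^ A := by ring
            _ ≤ 1 * n ^ A := by gcongr
            _ = _ := one_mul _

lemma hsENorm_sum_le (s : ℝ) {ι : Type*} (S : Finset ι) (f : ι → Torus2 → ℂ)
    (hf : ∀ i, Integrable (f i)) :
    hsENorm s (fun x => ∑ i ∈ S, f i x) ≤ ∑ i ∈ S, hsENorm s (f i) := by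
  classical
  induction S using Finset.induction_on with
  | empty => simp [hsENorm_const]
  | insert i S hi ih =>
    simp only [Finset.sum_insert hi]
    refine (hsENorm_add_le s (hf i) (integrable_finsetSum _ fun i _ => hf i)).trans ?_
    gcongr

/-- Fatou's lemma on the frequency lattice; it spares any proof of convergence in `H^s`. -/
lemma hsENorm_le_of_tendsto {s : ℝ} {f : ℕ → Torus2 → ℂ} {g : Torus2 → ℂ} {B : ℝ≥0∞}
    (h : ∀ k, Tendsto (fun n => torusFourierCoeff (f n) k) atTop (𝓝 (torusFourierCoeff g k)))
    (hB : ∀ n, hsENorm s (f n) ≤ B) : hsENorm s g ≤ B := by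
  unfold hsENorm at *
  refine (Lp.eLpNorm_lim_le_liminf_eLpNorm (fun n => aestronglyMeasurable_count _) _
    (ae_of_all _ fun k => (h k).const_mul _)).trans ?_
  exact liminf_le_of_frequently_le' (Frequently.of_forall hB)

/-- **Moser estimate** for power series without constant term. -/
lemma exists_hsENorm_powerSeries_le {s : ℝ} (hs : 0 < s) :
    ∃ A : ℕ, ∀ (a : ℕ → ℂ) (r : ℝ) (w f : Torus2 → ℂ), AEStronglyMeasurable w volume →
      (∀ᵐ x, ‖w x‖ ≤ r) → (Summable fun n : ℕ => ‖a n‖ * (((n + 1 : ℕ) : ℝ) ^ A * r ^ n)) →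
      (∀ᵐ x, HasSum (fun n => a n * w x ^ (n + 1)) (f x)) →
      hsENorm s f ≤ ENNReal.ofReal (∑' n : ℕ, ‖a n‖ * (((n + 1 : ℕ) : ℝ) ^ A * r ^ n)) *
        hsENorm s w := by
  obtain ⟨A, hA⟩ := exists_hsENorm_pow_le hs
  refine ⟨A, fun a r w f hw hr hsum hf => ?_⟩
  have hr0 : 0 ≤ r := by
    obtain ⟨x, hx⟩ := hr.exists
    exact (norm_nonneg _).trans hx
  set T := ∑' n : ℕ, ‖a n‖ * (((n + 1 : ℕ) : ℝ) ^ A * r ^ n) with hT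
  have hmeas : ∀ n, AEStronglyMeasurable (fun x => a n * w x ^ (n + 1)) volume := fun n =>
    (hw.pow (n + 1)).const_mul _
  have hint : ∀ n, Integrable (fun x => a n * w x ^ (n + 1)) := fun n =>
    ((hw.pow (n + 1)).integrable_of_bound_torus (ae_norm_pow_le hr (n + 1))).const_mul _
  have hpart : ∀ N, ∑ n ∈ Finset.range N, ‖a n‖ * (((n + 1 : ℕ) : ℝ) ^ A * r ^ n) ≤ T := fun N =>
    hsum.sum_le_tsum _ (fun n _ => by positivity)
  apply hsENorm_le_of_tendsto (f := fun N x => ∑ n ∈ Finset.range N, a n * w x ^ (n + 1))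
  · intro k
    simp only [torusFourierCoeff_eq]
    apply Tendsto.const_mul
    -- Since `(n + 1)^A ≥ 1`, the sum `T` that bounds the Sobolev norms also majorises the series
    -- pointwise.
    apply tendsto_integral_of_dominated_convergence (fun _ => T * r)
    · intro N
      have : AEStronglyMeasurable (fun x => ∑ n ∈ Finset.range N, a n * w x ^ (n + 1)) volume :=
        Finset.aestronglyMeasurable_fun_sum _ fun n _ => hmeas n
      exact this.mul (torusMonomial (-k)).continuous.aestronglyMeasurable
    · exact integrable_const _
    · intro N
      filter_upwards [hr] with x hx
      rw [norm_mul, norm_torusMonomial_apply, mul_one]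
      refine (norm_sum_le _ _).trans ?_
      refine le_trans ?_ (mul_le_mul_of_nonneg_right (hpart N) hr0)
      rw [Finset.sum_mul]
      refine Finset.sum_le_sum fun n _ => ?_
      rw [norm_mul, norm_pow, mul_assoc, mul_assoc, ← pow_succ]
      gcongr
      refine (pow_le_pow_left₀ (norm_nonneg _) hx _).trans ?_
      refine le_mul_of_one_le_left (by positivity) (one_le_pow₀ ?_)
      exact_mod_cast Nat.succ_le_succ n.zero_le
    · filter_upwards [hf] with x hx
      exact hx.tendsto_sum_nat.mul_const _
  · intro N
    refine (hsENorm_sum_le s _ _ hint).trans ?_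
    calc ∑ n ∈ Finset.range N, hsENorm s (fun x => a n * w x ^ (n + 1))
        ≤ ∑ n ∈ Finset.range N,
          ENNReal.ofReal (‖a n‖ * (((n + 1 : ℕ) : ℝ) ^ A * r ^ n)) * hsENorm s w := by
          refine Finset.sum_le_sum fun n _ => ?_
          rw [hsENorm_const_mul, ENNReal.ofReal_mul (norm_nonneg _), ofReal_norm, mul_assoc]
          gcongr
          exact hA w r hw hr (n + 1) (by omega)
      _ = ENNReal.ofReal (∑ n ∈ Finset.range N, ‖a n‖ * (((n + 1 : ℕ) : ℝ) ^ A * r ^ n)) *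
          hsENorm s w := by
          rw [← Finset.sum_mul, ENNReal.ofReal_sum_of_nonneg fun n _ => by positivity]
      _ ≤ _ := by
          gcongr
          exact hpart N

/-- The Taylor coefficients of the logarithm are bounded by one, and `∑ n^A rⁿ` converges for every
`r < 1`. -/
lemma exists_hsENorm_log_le {s r : ℝ} (hs : 0 < s) (hr0 : 0 < r) (hr1 : r < 1) :
    ∃ C : ℝ, 0 ≤ C ∧ ∀ w : Torus2 → ℂ, AEStronglyMeasurable w volume → (∀ᵐ x, ‖w x‖ ≤ r) →
      hsENorm s (fun x => Complex.log (1 + w x)) ≤ ENNReal.ofReal C * hsENorm s w := by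
  obtain ⟨A, hA⟩ := exists_hsENorm_powerSeries_le hs
  set a : ℕ → ℂ := fun n => (-1) ^ (n + 2) / ((n + 1 : ℕ) : ℂ) with ha
  have hsum : Summable fun n : ℕ => ‖a n‖ * (((n + 1 : ℕ) : ℝ) ^ A * r ^ n) := by
    have h := (summable_nat_add_iff 1).mpr (summable_pow_mul_geometric_of_norm_lt_one A
      (r := r) (by rwa [Real.norm_eq_abs, abs_of_pos hr0]))
    refine Summable.of_nonneg_of_le (fun n => by positivity) (fun n => ?_) (h.mul_left r⁻¹)
    have h1 : ‖a n‖ ≤ 1 := by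
      rw [ha]
      simp only [norm_div, norm_pow, norm_neg, norm_one, one_pow, Complex.norm_natCast]
      rw [div_le_one (by positivity)]
      exact_mod_cast Nat.succ_le_succ n.zero_le
    calc ‖a n‖ * (((n + 1 : ℕ) : ℝ) ^ A * r ^ n) ≤ 1 * (((n + 1 : ℕ) : ℝ) ^ A * r ^ n) := by
          gcongr
      _ = r⁻¹ * (((n + 1 : ℕ) : ℝ) ^ A * r ^ (n + 1)) := by
          rw [pow_succ]; field_simp
  refine ⟨_, tsum_nonneg fun n => by positivity, fun w hw hwr => hA a r w _ hw hwr hsum ?_⟩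
  filter_upwards [hwr] with x hx
  have h := Complex.hasSum_taylorSeries_log (z := w x) (hx.trans_lt hr1)
  rw [← hasSum_nat_add_iff' 1] at h
  simp only [Finset.sum_range_one, Nat.cast_zero, div_zero, sub_zero] at h
  convert! h using 2 with n
  rw [ha]; simp only; ring

lemma exists_hsENorm_exp_sub_one_le {s r : ℝ} (hs : 0 < s) :
    ∃ C : ℝ, 0 ≤ C ∧ ∀ w : Torus2 → ℂ, AEStronglyMeasurable w volume → (∀ᵐ x, ‖w x‖ ≤ r) →
      hsENorm s (fun x => Complex.exp (w x) - 1) ≤ ENNReal.ofReal C * hsENorm s w := by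
  obtain ⟨A, hA⟩ := exists_hsENorm_powerSeries_le hs
  rcases lt_or_ge r 0 with hr0 | hr0
  · refine ⟨0, le_rfl, fun w _ hwr => ?_⟩
    obtain ⟨x, hx⟩ := hwr.exists
    exact absurd ((norm_nonneg _).trans hx) (not_le.mpr hr0)
  set a : ℕ → ℂ := fun n => ((n + 1).factorial : ℂ)⁻¹ with ha
  have hsum : Summable fun n : ℕ => ‖a n‖ * (((n + 1 : ℕ) : ℝ) ^ A * r ^ n) := by
    have h := (Real.summable_pow_div_factorial (Real.exp 1 * r)).mul_left
      (A.factorial * Real.exp 1)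
    refine Summable.of_nonneg_of_le (fun n => by positivity) (fun n => ?_) h
    -- The bound `(n + 1)^A ≤ A! e^(n+1)` reduces the series to the exponential series at `e·r`.
    have h1 := Real.pow_div_factorial_le_exp ((n + 1 : ℕ) : ℝ) (by positivity) A
    rw [div_le_iff₀ (by positivity)] at h1
    have h2 : ‖a n‖ ≤ (n.factorial : ℝ)⁻¹ := by
      rw [ha]
      simp only [norm_inv, Complex.norm_natCast]
      gcongr
      omega
    calc ‖a n‖ * (((n + 1 : ℕ) : ℝ) ^ A * r ^ n)
        ≤ (n.factorial : ℝ)⁻¹ * ((Real.exp ((n + 1 : ℕ) : ℝ) * A.factorial) * r ^ n) := by gcongr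
      _ = _ := by
          have : Real.exp ((n + 1 : ℕ) : ℝ) = Real.exp 1 ^ n * Real.exp 1 := by
            rw [← pow_succ, ← Real.exp_nat_mul, mul_one]
          rw [this, mul_pow]
          ring
  refine ⟨_, tsum_nonneg fun n => by positivity, fun w hw hwr => hA a r w _ hw hwr hsum ?_⟩
  refine ae_of_all _ fun x => ?_
  have h := NormedSpace.expSeries_div_hasSum_exp (𝔸 := ℂ) (w x)
  rw [← Complex.exp_eq_exp_ℂ, ← hasSum_nat_add_iff' 1] at h
  simp only [Finset.sum_range_one, pow_zero, Nat.factorial_zero, Nat.cast_one, div_one] at h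
  convert! h using 2 with n
  rw [ha]; simp only; ring

/-! ### Continuous representatives and continuous phases -/

lemma norm_sq_le_japaneseSq (k : Fin 2 → ℤ) : ‖k‖ ^ 2 ≤ japaneseSq k := by
  have h : ‖k‖ ≤ Real.sqrt (japaneseSq k) := by
    rw [pi_norm_le_iff_of_nonneg (Real.sqrt_nonneg _)]
    intro i
    apply Real.le_sqrt_of_sq_le
    rw [Int.norm_eq_abs, sq_abs, japaneseSq]
    have : (k i : ℝ) ^ 2 ≤ ∑ j, (k j : ℝ) ^ 2 :=
      Finset.single_le_sum (f := fun j => (k j : ℝ) ^ 2) (fun j _ => sq_nonneg _)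
        (Finset.mem_univ i)
    linarith
  calc ‖k‖ ^ 2 ≤ Real.sqrt (japaneseSq k) ^ 2 := by gcongr
    _ = _ := Real.sq_sqrt (japaneseSq_pos k).le

lemma summable_japaneseSq_rpow {s : ℝ} (hs : 1 < s) :
    Summable fun k : Fin 2 → ℤ => japaneseSq k ^ (-s) := by
  apply (EisensteinSeries.summable_one_div_norm_rpow
    (show 2 < 2 * s by linarith)).of_norm_bounded_eventually
  have h0 : ∀ᶠ k : Fin 2 → ℤ in cofinite, k ≠ 0 := by
    rw [eventually_cofinite]; simp
  filter_upwards [h0] with k hk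
  have hk' : 0 < ‖k‖ := norm_pos_iff.mpr hk
  rw [Real.norm_eq_abs, abs_of_pos (Real.rpow_pos_of_pos (japaneseSq_pos k) _),
    show -(2 * s) = 2 * (-s) by ring, Real.rpow_mul hk'.le, Real.rpow_two]
  exact Real.rpow_le_rpow_of_nonpos (by positivity) (norm_sq_le_japaneseSq k) (by linarith)

lemma summable_of_hsENorm_ne_top {s : ℝ} {f : Torus2 → ℂ} (h : hsENorm s f ≠ ⊤) :
    Summable fun k => japaneseSq k ^ s * ‖torusFourierCoeff f k‖ ^ 2 := by
  have h2 : hsENorm s f ^ 2 ≠ ⊤ := ENNReal.pow_ne_top h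
  rw [hsENorm_sq] at h2
  have := ENNReal.summable_toReal h2
  refine this.congr fun k => ?_
  have hJ := Real.rpow_nonneg (japaneseSq_pos k).le s
  rw [enorm_sq_eq_ofReal, ENNReal.toReal_mul, ENNReal.toReal_ofReal hJ,
    ENNReal.toReal_ofReal (sq_nonneg _)]

/-- Sobolev embedding in dimension two: `2|f̂| ≤ ⟨k⟩^{2s}|f̂|² + ⟨k⟩^{-2s}`, and the last term is
summable exactly because `2s > 2`. -/
lemma summable_norm_torusFourierCoeff {s : ℝ} (hs : 1 < s) {f : Torus2 → ℂ}
    (h : hsENorm s f ≠ ⊤) : Summable fun k => ‖torusFourierCoeff f k‖ := by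
  refine Summable.of_nonneg_of_le (fun k => norm_nonneg _) (fun k => ?_)
    ((summable_of_hsENorm_ne_top h).add (summable_japaneseSq_rpow hs))
  set t := ‖torusFourierCoeff f k‖
  have hJ : 0 < japaneseSq k ^ s := Real.rpow_pos_of_pos (japaneseSq_pos k) s
  rw [Real.rpow_neg (japaneseSq_pos k).le]
  set y := japaneseSq k ^ s
  have h1 : 0 ≤ (y * t - 1) ^ 2 / y := by positivity
  have h2 : (y * t - 1) ^ 2 / y = y * t ^ 2 - 2 * t + y⁻¹ := by field_simp; ring
  have : 0 ≤ t := norm_nonneg _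
  linarith

lemma exists_continuous_ae_eq {f : Torus2 → ℂ} (hf : Integrable f)
    (h : Summable fun k => ‖torusFourierCoeff f k‖) :
    ∃ F : Torus2 → ℂ, Continuous F ∧ f =ᵐ[volume] F := by
  have hn : ∀ k, ‖torusMonomial k‖ ≤ 1 := fun k =>
    (ContinuousMap.norm_le _ zero_le_one).mpr fun x => (norm_torusMonomial_apply k x).le
  have hs : Summable fun k => torusFourierCoeff f k • torusMonomial k := by
    refine Summable.of_norm (Summable.of_nonneg_of_le (fun k => norm_nonneg _) (fun k => ?_) h)
    rw [norm_smul]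
    exact mul_le_of_le_one_right (norm_nonneg _) (hn k)
  set F := ∑' k, torusFourierCoeff f k • torusMonomial k with hF
  refine ⟨F, F.continuous, ?_⟩
  have hco : ∀ κ, torusFourierCoeff F κ = torusFourierCoeff f κ := by
    intro κ
    let L : C(Torus2, ℂ) →ₗ[ℂ] ℂ :=
      { toFun := fun φ => torusFourierCoeff φ κ
        map_add' := fun φ ψ => torusFourierCoeff_add φ.continuous.integrable_torus
          ψ.continuous.integrable_torus κ
        map_smul' := fun c φ => torusFourierCoeff_const_mul c φ κ }
    let L' : C(Torus2, ℂ) →L[ℂ] ℂ := L.mkContinuous 1 fun φ => by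
      rw [one_mul]
      exact torusFourierCoeff_norm_le (ae_of_all _ φ.norm_coe_le_norm) κ
    have h1 := L'.hasSum hs.hasSum
    have h2 : HasSum (fun k => L' (torusFourierCoeff f k • torusMonomial k))
        (torusFourierCoeff f κ) := by
      have : ∀ k, L' (torusFourierCoeff f k • torusMonomial k) =
          if k = κ then torusFourierCoeff f κ else 0 := by
        intro k
        rw [map_smul]
        change _ • torusFourierCoeff (torusMonomial k) κ = _
        rw [torusFourierCoeff_monomial]
        by_cases hk : k = κ
        · subst hk; simp
        · simp [hk, Ne.symm hk]
      simp only [this]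
      exact hasSum_ite_eq κ _
    exact h1.unique h2
  have hz := ae_eq_zero_of_torusFourierCoeff_eq_zero (hf.sub F.continuous.integrable_torus)
    (fun k => (torusFourierCoeff_sub hf F.continuous.integrable_torus k).trans
      (by rw [hco, sub_self]))
  filter_upwards [hz] with x hx
  exact sub_eq_zero.mp hx

/-- The exceptional set is open and null, and nonempty open sets of the torus have positive volume.
-/
lemma Continuous.forall_of_ae_mem {X : Type*} [TopologicalSpace X] {F : Torus2 → X}
    (hF : Continuous F) {K : Set X} (hK : IsClosed K) (h : ∀ᵐ x, F x ∈ K) (x : Torus2) :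
    F x ∈ K := by
  have h1 : (volume : Measure Torus2) (F ⁻¹' Kᶜ) = 0 := h
  rw [IsOpen.measure_eq_zero_iff _ (hK.isOpen_compl.preimage hF)] at h1
  by_contra hx
  exact (Set.eq_empty_iff_forall_notMem.mp h1 x) hx

lemma eq_norm_mul_exp_arg_div {c u : ℂ} {φ : ℝ} (hc0 : c ≠ 0)
    (hc : c = ‖c‖ * Complex.exp (Complex.I * φ)) :
    u = ‖u‖ * Complex.exp (Complex.I * ((φ + (u / c).arg : ℝ) : ℂ)) := by
  have h := Complex.norm_mul_exp_arg_mul_I (u / c)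
  have h2 : (‖c‖ : ℂ) ≠ 0 := by exact_mod_cast (norm_pos_iff.mpr hc0).ne'
  rw [norm_div, Complex.ofReal_div] at h
  calc u = c * (u / c) := by field_simp
    _ = ‖c‖ * Complex.exp (Complex.I * φ) *
        (‖u‖ / ‖c‖ * Complex.exp ((u / c).arg * Complex.I)) := by
      rw [h, ← hc]
    _ = ‖u‖ * (Complex.exp (Complex.I * φ) * Complex.exp ((u / c).arg * Complex.I)) := by
      field_simp
    _ = _ := by
      rw [← Complex.exp_add]; congr 2; push_cast; ring

lemma norm_div_sub_one_le {c u : ℂ} (hc0 : c ≠ 0) (h : ‖u - c‖ ≤ ‖c‖ / 2) :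
    ‖u / c - 1‖ ≤ 1 / 2 := by
  have hc := norm_pos_iff.mpr hc0
  rw [show u / c - 1 = (u - c) / c by field_simp, norm_div, div_le_iff₀ hc]
  linarith

/-- The continuous representative of `u` lies in the closed disc at every point, so its quotient by
`c` avoids the branch cut of `arg`. -/
lemma exists_continuous_arg {u : Torus2 → ℂ} {c : ℂ} {s : ℝ} (hs : 1 < s) (hu : Integrable u)
    (hus : hsENorm s u ≠ ⊤) (hc0 : c ≠ 0) (hb : ∀ᵐ x, ‖u x - c‖ ≤ ‖c‖ / 2) :
    ∃ Θ : Torus2 → ℝ, Continuous Θ ∧ ∀ᵐ x, Θ x = (u x / c).arg := by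
  obtain ⟨F, hF, hFu⟩ := exists_continuous_ae_eq hu (summable_norm_torusFourierCoeff hs hus)
  have hFb : ∀ x, F x ∈ Metric.closedBall c (‖c‖ / 2) := by
    apply hF.forall_of_ae_mem Metric.isClosed_closedBall
    filter_upwards [hb, hFu] with x h1 h2
    rwa [mem_closedBall_iff_norm, ← h2]
  refine ⟨fun x => (F x / c).arg, ?_, ?_⟩
  · rw [continuous_iff_continuousAt]
    intro x
    have : F x / c ∈ Complex.slitPlane := by
      apply Complex.mem_slitPlane_of_norm_lt_one (z := F x / c - 1) _ |> fun h => by simpa using h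
      have := hFb x
      rw [mem_closedBall_iff_norm] at this
      linarith [norm_div_sub_one_le hc0 this]
    exact ContinuousAt.comp (f := fun x => F x / c) (g := Complex.arg)
      (Complex.continuousAt_arg this) (hF.div_const c).continuousAt
  · filter_upwards [hFu] with x hx
    rw [hx]

/-- Two continuous phases differ by a constant. -/
lemma phase_unique {u : Torus2 → ℂ} {θ θ' : Torus2 → ℝ} (hu : ∀ᵐ x, u x ≠ 0)
    (hθ : Continuous θ) (hθ' : Continuous θ')
    (h : ∀ᵐ x, u x = ‖u x‖ * Complex.exp (Complex.I * (θ x : ℂ)))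
    (h' : ∀ᵐ x, u x = ‖u x‖ * Complex.exp (Complex.I * (θ' x : ℂ))) :
    ∃ d : ℝ, ∀ x, θ x = θ' x + d := by
  have hD : Continuous fun x => θ x - θ' x := hθ.sub hθ'
  have hE : Continuous fun x => Complex.exp (Complex.I * ((θ x - θ' x : ℝ) : ℂ)) := by fun_prop
  have hone : ∀ x, Complex.exp (Complex.I * ((θ x - θ' x : ℝ) : ℂ)) ∈ ({1} : Set ℂ) := by
    apply hE.forall_of_ae_mem isClosed_singleton
    filter_upwards [hu, h, h'] with x h0 h1 h2
    have hn : (‖u x‖ : ℂ) ≠ 0 := by exact_mod_cast (norm_pos_iff.mpr h0).ne'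
    have h3 := mul_left_cancel₀ hn (h1.symm.trans h2)
    rw [Set.mem_singleton_iff, Complex.ofReal_sub, mul_sub, Complex.exp_sub, h3,
      div_self (Complex.exp_ne_zero _)]
  have hint : ∀ x, ∃ n : ℤ, θ x - θ' x = n * (2 * Real.pi) := by
    intro x
    obtain ⟨n, hn⟩ := Complex.exp_eq_one_iff.mp (hone x)
    refine ⟨n, ?_⟩
    have h3 : Complex.I * ((θ x - θ' x : ℝ) : ℂ) = Complex.I * ((n * (2 * Real.pi) : ℝ) : ℂ) := by
      rw [hn]; push_cast; ring
    exact_mod_cast mul_left_cancel₀ Complex.I_ne_zero h3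
  -- The difference is continuous with values in the discrete set `2πℤ`, hence constant on the
  -- connected torus.
  have hloc : IsLocallyConstant fun x => θ x - θ' x := by
    rw [IsLocallyConstant.iff_eventually_eq]
    intro x
    filter_upwards [hD.continuousAt.eventually (Metric.ball_mem_nhds _ one_pos)] with y hy
    obtain ⟨n, hn⟩ := hint x
    obtain ⟨k, hk⟩ := hint y
    rw [Real.dist_eq, hn, hk, ← sub_mul, abs_mul,
      abs_of_pos Real.two_pi_pos] at hy
    have hlt : |((k - n : ℤ) : ℝ)| < 1 := by
      push_cast
      by_contra hge
      push Not at hge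
      nlinarith [Real.pi_gt_three]
    rw [← Int.cast_abs] at hlt
    have : |k - n| < 1 := by exact_mod_cast hlt
    rw [Int.abs_lt_one_iff, sub_eq_zero] at this
    rw [hn, hk, this]
  refine ⟨θ 0 - θ' 0, fun x => ?_⟩
  have : θ x - θ' x = θ 0 - θ' 0 := hloc.apply_eq_of_preconnectedSpace x 0
  linarith

/-! ### Weak gradients -/

/-- The covering map `ℝ² → 𝕋²`. -/
noncomputable def torusMk (y : Fin 2 → ℝ) : Torus2 := fun j => (y j : AddCircle (2 * Real.pi))

lemma isOpenQuotientMap_torusMk : IsOpenQuotientMap torusMk :=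
  IsOpenQuotientMap.piMap fun _ => QuotientAddGroup.isOpenQuotientMap_mk

lemma torusMk_add_smul (y : Fin 2 → ℝ) (j : Fin 2) (t : ℝ) :
    torusMk y + Pi.single j (t : AddCircle (2 * Real.pi)) =
      torusMk (y + t • Pi.single j 1) := by
  ext i
  by_cases h : i = j
  · subst h; simp [torusMk]
  · simp [torusMk, h]

lemma torusMonomial_torusMk (k : Fin 2 → ℤ) (y : Fin 2 → ℝ) :
    torusMonomial k (torusMk y) = Complex.exp (Complex.I * ((∑ j, k j * y j : ℝ) : ℂ)) := by
  rw [torusMonomial_apply]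
  have h2 : ((2 * Real.pi : ℝ) : ℂ) ≠ 0 := by exact_mod_cast Real.two_pi_pos.ne'
  have : ∀ j, (fourier (k j) (torusMk y j) : ℂ) = Complex.exp (Complex.I * (k j * y j)) := by
    intro j
    rw [torusMk, fourier_coe_apply]
    congr 1
    push_cast at h2 ⊢
    field_simp
  simp only [this, ← Complex.exp_sum, ← Finset.mul_sum]
  push_cast; rfl

lemma torusMonomial_single_coe (k : Fin 2 → ℤ) (j : Fin 2) (t : ℝ) :
    torusMonomial k (Pi.single j (t : AddCircle (2 * Real.pi))) =
      Complex.exp (Complex.I * k j * t) := by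
  have h := torusMk_add_smul 0 j t
  have h0 : torusMk 0 = 0 := by ext i; simp [torusMk]
  rw [h0, zero_add, zero_add] at h
  rw [h, torusMonomial_torusMk]
  congr 1
  simp only [Pi.smul_apply, Pi.single_apply, smul_eq_mul, mul_ite, mul_one, mul_zero,
    Finset.sum_ite_eq', Finset.mem_univ, if_true]
  push_cast; ring

lemma hasDerivAt_torusMonomial (k : Fin 2 → ℤ) (j : Fin 2) (x : Torus2) :
    HasDerivAt (fun t : ℝ => torusMonomial k (x + Pi.single j (t : AddCircle (2 * Real.pi))))
      (Complex.I * k j * torusMonomial k x) 0 := by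
  simp only [torusMonomial_arg_add, torusMonomial_single_coe]
  have h1 : HasDerivAt (fun t : ℝ => Complex.I * k j * (t : ℂ)) (Complex.I * k j) 0 := by
    simpa using (Complex.ofRealCLM.hasDerivAt (x := (0 : ℝ))).const_mul (Complex.I * k j)
  convert! (h1.cexp).const_mul (torusMonomial k x) using 1
  simp; ring

lemma torusSmooth_re_torusMonomial (k : Fin 2 → ℤ) :
    TorusSmooth fun x => (torusMonomial k x).re := by
  change ContDiff ℝ ∞ fun y => (torusMonomial k (torusMk y)).re
  simp only [torusMonomial_torusMk, mul_comm Complex.I, Complex.exp_ofReal_mul_I_re]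
  fun_prop

lemma torusSmooth_im_torusMonomial (k : Fin 2 → ℤ) :
    TorusSmooth fun x => (torusMonomial k x).im := by
  change ContDiff ℝ ∞ fun y => (torusMonomial k (torusMk y)).im
  simp only [torusMonomial_torusMk, mul_comm Complex.I, Complex.exp_ofReal_mul_I_im]
  fun_prop

lemma torusPartial_re_torusMonomial (k : Fin 2 → ℤ) (j : Fin 2) (x : Torus2) :
    torusPartial j (fun x => (torusMonomial k x).re) x =
      (Complex.I * k j * torusMonomial k x).re :=
  (Complex.reCLM.hasFDerivAt.comp_hasDerivAt _ (hasDerivAt_torusMonomial k j x)).deriv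

lemma torusPartial_im_torusMonomial (k : Fin 2 → ℤ) (j : Fin 2) (x : Torus2) :
    torusPartial j (fun x => (torusMonomial k x).im) x =
      (Complex.I * k j * torusMonomial k x).im :=
  (Complex.imCLM.hasFDerivAt.comp_hasDerivAt _ (hasDerivAt_torusMonomial k j x)).deriv

lemma integral_ofReal_mul_eq {f : Torus2 → ℝ} (hf : Integrable f) {e : Torus2 → ℂ}
    (he : Continuous e) :
    ∫ x, (f x : ℂ) * e x = ((∫ x, f x * (e x).re : ℝ) : ℂ) + (∫ x, f x * (e x).im : ℝ) *
      Complex.I := by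
  obtain ⟨b, hb⟩ : ∃ b, ∀ x, ‖e x‖ ≤ b := by
    obtain ⟨b, hb⟩ := (isCompact_range he).isBounded.exists_norm_le
    exact ⟨b, fun x => hb _ ⟨x, rfl⟩⟩
  have hi : Integrable fun x => (f x : ℂ) * e x :=
    hf.ofReal.mul_bdd (c := b) he.aestronglyMeasurable (ae_of_all _ hb)
  have := integral_re_add_im hi
  rw [← this]
  simp

/-- The Fourier coefficients of a weak gradient. -/
lemma IsWeakGradient.torusFourierCoeff {θ : Torus2 → ℝ} {g : Fin 2 → Torus2 → ℝ}
    (h : IsWeakGradient θ g) (j : Fin 2) (k : Fin 2 → ℤ) :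
    torusFourierCoeff (fun x => (g j x : ℂ)) k =
      Complex.I * k j * torusFourierCoeff (fun x => (θ x : ℂ)) k := by
  obtain ⟨hθ, h⟩ := h
  obtain ⟨hg, h⟩ := h j
  -- Test functions are real, so the monomial `e^{-ik·x}` is tested through its real and imaginary
  -- parts.
  have hre := h _ (torusSmooth_re_torusMonomial (-k))
  have him := h _ (torusSmooth_im_torusMonomial (-k))
  simp only [torusPartial_re_torusMonomial, torusPartial_im_torusMonomial] at hre him
  have e1 := integral_ofReal_mul_eq hθ (e := fun x => Complex.I * ((-k) j : ℤ) * torusMonomial (-k) x)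
    (by fun_prop)
  have e2 := integral_ofReal_mul_eq hg (e := torusMonomial (-k)) (by fun_prop)
  rw [hre, him] at e1
  have e3 : ∫ x, (θ x : ℂ) * (Complex.I * ((-k) j : ℤ) * torusMonomial (-k) x) =
      -(Complex.I * k j) * ∫ x, (θ x : ℂ) * torusMonomial (-k) x := by
    rw [← integral_const_mul]
    congr 1; ext x
    simp; ring
  rw [torusFourierCoeff_eq, torusFourierCoeff_eq, e2]
  rw [e3] at e1
  push_cast at e1
  linear_combination (((2 * Real.pi) ^ 2 : ℝ) : ℂ)⁻¹ * e1

lemma TorusSmooth.continuous {ψ : Torus2 → ℝ} (h : TorusSmooth ψ) : Continuous ψ := by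
  rw [isOpenQuotientMap_torusMk.isQuotientMap.continuous_iff]
  exact ContDiff.continuous h

lemma TorusSmooth.hasDerivAt {ψ : Torus2 → ℝ} (h : TorusSmooth ψ) (j : Fin 2) (x : Torus2)
    (t : ℝ) :
    HasDerivAt (fun t : ℝ => ψ (x + Pi.single j (t : AddCircle (2 * Real.pi))))
      (torusPartial j ψ (x + Pi.single j (t : AddCircle (2 * Real.pi)))) t := by
  have key : ∀ (x : Torus2), HasDerivAt
      (fun t : ℝ => ψ (x + Pi.single j (t : AddCircle (2 * Real.pi)))) (torusPartial j ψ x) 0 := by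
    intro x
    apply DifferentiableAt.hasDerivAt
    obtain ⟨y, rfl⟩ := isOpenQuotientMap_torusMk.surjective x
    simp only [torusMk_add_smul]
    have hd : Differentiable ℝ fun y => ψ (torusMk y) := ContDiff.differentiable h (by simp)
    have := hd.comp (g := fun y => ψ (torusMk y))
      (by fun_prop : Differentiable ℝ fun t : ℝ => y + t • Pi.single (M := fun _ => ℝ) j 1)
    exact this 0
  have h1 := key (x + Pi.single j (t : AddCircle (2 * Real.pi)))
  rw [← sub_self t] at h1
  have h3 := h1.comp_sub_const t t
  convert! h3 using 1
  ext s
  simp only [add_assoc, ← Pi.single_add]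
  rw [← AddCircle.coe_add]; congr 4; ring

lemma TorusSmooth.continuous_torusPartial {ψ : Torus2 → ℝ} (h : TorusSmooth ψ) (j : Fin 2) :
    Continuous (torusPartial j ψ) := by
  rw [isOpenQuotientMap_torusMk.isQuotientMap.continuous_iff]
  have hd : Differentiable ℝ fun y => ψ (torusMk y) := ContDiff.differentiable h (by simp)
  have : (torusPartial j ψ ∘ torusMk) =
      fun y => fderiv ℝ (fun y => ψ (torusMk y)) y (Pi.single j 1) := by
    ext y
    simp only [Function.comp_apply, torusPartial, torusMk_add_smul]
    exact ((hd y).hasFDerivAt.hasLineDerivAt (Pi.single j 1)).deriv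
  rw [this]
  exact (ContDiff.continuous_fderiv h (by simp)).clm_apply continuous_const

lemma hasDerivAt_integral_torus {F F' : ℝ → Torus2 → ℂ} {b : ℝ} (hF : ∀ t, Continuous (F t))
    (hF' : Continuous (F' 0)) (hb : ∀ᵐ x, ∀ t ∈ (Set.univ : Set ℝ), ‖F' t x‖ ≤ b)
    (hd : ∀ᵐ x, ∀ t ∈ (Set.univ : Set ℝ), HasDerivAt (fun t => F t x) (F' t x) t) :
    HasDerivAt (fun t => ∫ x, F t x) (∫ x, F' 0 x) 0 :=
  (hasDerivAt_integral_of_dominated_loc_of_deriv_le Filter.univ_mem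
    (Eventually.of_forall fun t => (hF t).aestronglyMeasurable) (hF 0).integrable_torus
    hF'.aestronglyMeasurable hb (integrable_const b) hd).2

/-- Integration by parts obtained from translation invariance: shifting `ψ` by `t e_j` multiplies
its coefficient by `e^{i k_j t}`, and one differentiates at `t = 0` under the integral. -/
lemma TorusSmooth.torusFourierCoeff_torusPartial {ψ : Torus2 → ℝ} (h : TorusSmooth ψ) (j : Fin 2)
    (k : Fin 2 → ℤ) :
    torusFourierCoeff (fun x => (torusPartial j ψ x : ℂ)) k =
      Complex.I * k j * torusFourierCoeff (fun x => (ψ x : ℂ)) k := by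
  have hψ := h.continuous
  have hP := h.continuous_torusPartial j
  have hder := h.hasDerivAt j
  generalize torusPartial j ψ = P at hP hder ⊢
  obtain ⟨b, hb⟩ : ∃ b, ∀ x, ‖P x‖ ≤ b := by
    obtain ⟨b, hb⟩ := (isCompact_range hP).isBounded.exists_norm_le
    exact ⟨b, fun x => hb _ ⟨x, rfl⟩⟩
  obtain ⟨F, hF⟩ : ∃ F : ℝ → Torus2 → ℂ, F = fun (t : ℝ) x =>
      (ψ (x + Pi.single j (t : AddCircle (2 * Real.pi))) : ℂ) * torusMonomial (-k) x := ⟨_, rfl⟩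
  obtain ⟨F', hF'⟩ : ∃ F' : ℝ → Torus2 → ℂ, F' = fun (t : ℝ) x =>
      (P (x + Pi.single j (t : AddCircle (2 * Real.pi))) : ℂ) * torusMonomial (-k) x := ⟨_, rfl⟩
  have hc : ∀ t, Continuous (F t) := by intro t; rw [hF]; fun_prop
  have hc' : Continuous (F' 0) := by rw [hF']; fun_prop
  have hbd : ∀ᵐ x : Torus2, ∀ t ∈ (Set.univ : Set ℝ), ‖F' t x‖ ≤ b :=
    ae_of_all _ fun x t _ => by
      rw [hF', norm_mul, norm_torusMonomial_apply, mul_one, Complex.norm_real]; exact hb _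
  have hdiff : ∀ᵐ x : Torus2, ∀ t ∈ (Set.univ : Set ℝ),
      HasDerivAt (fun t => F t x) (F' t x) t :=
    ae_of_all _ fun x t _ => by
      rw [hF, hF']; exact ((hder x t).ofReal_comp).mul_const _
  have hD := hasDerivAt_integral_torus hc hc' hbd hdiff
  rw [hF, hF'] at hD
  beta_reduce at hD
  have hshift : ∀ t : ℝ, ∫ x, (ψ (x + Pi.single j (t : AddCircle (2 * Real.pi))) : ℂ) *
      torusMonomial (-k) x = Complex.exp (Complex.I * k j * t) *
        ∫ x, (ψ x : ℂ) * torusMonomial (-k) x := by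
    intro t
    have := integral_add_right_eq_self (μ := (volume : Measure Torus2))
      (fun x => (ψ x : ℂ) * torusMonomial (-k) x) (Pi.single j (t : AddCircle (2 * Real.pi)))
    rw [← this, ← integral_const_mul]
    congr 1; ext x
    rw [torusMonomial_arg_add, torusMonomial_single_coe]
    have : Complex.exp (Complex.I * k j * t) * Complex.exp (Complex.I * ((-k) j : ℤ) * t) = 1 := by
      rw [← Complex.exp_add, ← Complex.exp_zero]; congr 1; simp
    linear_combination -(ψ (x + Pi.single j (t : AddCircle (2 * Real.pi))) : ℂ) *
      torusMonomial (-k) x * this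
  simp only [hshift] at hD
  have h1 : HasDerivAt (fun t : ℝ => Complex.I * k j * (t : ℂ)) (Complex.I * k j) 0 := by
    simpa using (Complex.ofRealCLM.hasDerivAt (x := (0 : ℝ))).const_mul (Complex.I * k j)
  have h2 := (h1.cexp).mul_const (∫ x, (ψ x : ℂ) * torusMonomial (-k) x)
  have h3 := hD.unique h2
  have h0 : (Pi.single j ((0 : ℝ) : AddCircle (2 * Real.pi)) : Torus2) = 0 := by simp
  simp only [h0, add_zero, Complex.ofReal_zero, mul_zero, Complex.exp_zero, one_mul] at h3
  rw [torusFourierCoeff_eq, torusFourierCoeff_eq, h3]; ring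

lemma torusFourierCoeff_ofReal_neg (f : Torus2 → ℝ) (k : Fin 2 → ℤ) :
    torusFourierCoeff (fun x => (f x : ℂ)) (-k) =
      conj (torusFourierCoeff (fun x => (f x : ℂ)) k) := by
  have := torusFourierCoeff_conj (fun x => (f x : ℂ)) (-k)
  simpa only [Complex.conj_ofReal, neg_neg] using this

lemma integral_mul_eq_tsum {f h : Torus2 → ℝ} (hf : MemLp (fun x => (f x : ℂ)) 2 volume)
    (hh : MemLp (fun x => (h x : ℂ)) 2 volume) :
    ((∫ x, f x * h x : ℝ) : ℂ) = (((2 * Real.pi) ^ 2 : ℝ) : ℂ) *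
      ∑' k, conj (torusFourierCoeff (fun x => (f x : ℂ)) k) *
        torusFourierCoeff (fun x => (h x : ℂ)) k := by
  rw [(hasSum_conj_mul_torusFourierCoeff hf hh).tsum_eq, mul_inv_cancel_left₀ two_pi_sq_ne_zero]
  rw [← integral_complex_ofReal]
  simp

/-- A function with square summable `k_j θ̂(k)` has a weak gradient. -/
lemma exists_isWeakGradient {θ : Torus2 → ℝ} (hθ : MemLp (fun x => (θ x : ℂ)) 2 volume)
    (hsum : ∀ j : Fin 2, Summable fun k : Fin 2 → ℤ =>
      ‖Complex.I * k j * torusFourierCoeff (fun x => (θ x : ℂ)) k‖ ^ 2) :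
    ∃ g : Fin 2 → Torus2 → ℝ, IsWeakGradient θ g := by
  choose G hG hGc using fun j => exists_memLp_torusFourierCoeff_eq (hsum j)
  have hGi : ∀ j, Integrable (G j) := fun j => (hG j).integrable (by norm_num)
  have hgm : ∀ j, MemLp (fun x => ((G j x).re : ℂ)) 2 volume := fun j => (hG j).re.ofReal
  -- The Riesz–Fischer function `G j` is complex-valued, but `i k_j θ̂(k)` has the conjugation
  -- symmetry of a real function, so passing to the real part keeps the coefficients.
  have hgc : ∀ j k, torusFourierCoeff (fun x => ((G j x).re : ℂ)) k =
      Complex.I * k j * torusFourierCoeff (fun x => (θ x : ℂ)) k := by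
    intro j k
    have e : (fun x => ((G j x).re : ℂ)) = fun x => (1 / 2 : ℂ) * (G j x + conj (G j x)) := by
      ext x
      rw [Complex.add_conj]; push_cast; ring
    have hci : Integrable fun x => conj (G j x) := Complex.conjLIE.toContinuousLinearEquiv.toContinuousLinearMap.integrable_comp (hGi j)
    rw [e, torusFourierCoeff_const_mul, torusFourierCoeff_add (hGi j) hci, torusFourierCoeff_conj,
      hGc, hGc, torusFourierCoeff_ofReal_neg]
    simp only [map_mul, Complex.conj_I, Complex.conj_conj, Pi.neg_apply, Int.cast_neg, map_neg,
      map_intCast]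
    ring
  refine ⟨fun j x => (G j x).re, ?_, fun j => ⟨(hGi j).re, fun ψ hψ => ?_⟩⟩
  · simpa using (hθ.integrable (by norm_num)).re
  · have mem : ∀ {f : Torus2 → ℝ}, Continuous f → MemLp (fun x => (f x : ℂ)) 2 volume := by
      intro f hf
      have : Continuous fun x => (f x : ℂ) := by fun_prop
      exact this.memLp_of_hasCompactSupport (HasCompactSupport.of_compactSpace _)
    -- By Parseval the weak identity becomes a comparison of coefficients; its sign is that of the
    -- conjugate of `i`.
    have h1 := integral_mul_eq_tsum hθ (mem (hψ.continuous_torusPartial j))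
    have h2 := integral_mul_eq_tsum (hgm j) (mem hψ.continuous)
    have h3 : ((∫ x, θ x * torusPartial j ψ x : ℝ) : ℂ) =
        -((∫ x, (G j x).re * ψ x : ℝ) : ℂ) := by
      rw [h1, h2, ← mul_neg, ← tsum_neg]
      congr 2; ext k
      rw [hψ.torusFourierCoeff_torusPartial, hgc]
      simp only [map_mul, Complex.conj_I, map_intCast]
      ring
    exact_mod_cast h3

/-! ### Comparison of norms -/

lemma hsENorm_sq_eq_ofReal {s : ℝ} {f : Torus2 → ℂ}
    (h : Summable fun k => japaneseSq k ^ s * ‖torusFourierCoeff f k‖ ^ 2) :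
    hsENorm s f ^ 2 =
      ENNReal.ofReal (∑' k, japaneseSq k ^ s * ‖torusFourierCoeff f k‖ ^ 2) := by
  have hJ := fun k => Real.rpow_nonneg (japaneseSq_pos k).le s
  rw [hsENorm_sq, ENNReal.ofReal_tsum_of_nonneg (fun k => mul_nonneg (hJ k) (sq_nonneg _)) h]
  congr 1; ext k
  rw [enorm_sq_eq_ofReal, ENNReal.ofReal_mul (hJ k)]

lemma memHs_iff {s : ℝ} {f : Torus2 → ℂ} :
    MemHs s f ↔ MemLp f 2 volume ∧ hsENorm s f ≠ ⊤ := by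
  refine and_congr_right fun _ => ⟨fun h htop => ?_, summable_of_hsENorm_ne_top⟩
  have := hsENorm_sq_eq_ofReal h
  rw [htop] at this
  simp at this

lemma hsNorm_eq {s : ℝ} {f : Torus2 → ℂ} (h : hsENorm s f ≠ ⊤) :
    hsNorm s f = 2 * Real.pi * (hsENorm s f).toReal := by
  have hs := summable_of_hsENorm_ne_top h
  have hsq := hsENorm_sq_eq_ofReal hs
  have h0 : 0 ≤ ∑' k, japaneseSq k ^ s * ‖torusFourierCoeff f k‖ ^ 2 :=
    tsum_nonneg fun k => mul_nonneg (Real.rpow_nonneg (japaneseSq_pos k).le s) (sq_nonneg _)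
  have := congrArg ENNReal.toReal hsq
  rw [ENNReal.toReal_pow, ENNReal.toReal_ofReal h0] at this
  rw [hsNorm, ← this, Real.sqrt_sq ENNReal.toReal_nonneg]

lemma enorm_torusFourierCoeff_zero_le (s : ℝ) (f : Torus2 → ℂ) :
    ‖torusFourierCoeff f 0‖ₑ ≤ hsENorm s f := by
  rw [← ENNReal.pow_le_pow_left_iff two_ne_zero, hsENorm_sq]
  refine le_trans ?_ (ENNReal.le_tsum 0)
  simp [japaneseSq]

/-- The mean of `f` is within `r` of `c`, and it is one of the Fourier coefficients. This lower
bound is what absorbs additive constants later. -/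
lemma ofReal_le_hsENorm {f : Torus2 → ℂ} {c : ℂ} {r : ℝ} (s : ℝ) (hf : Integrable f)
    (h : ∀ᵐ x, ‖f x - c‖ ≤ r) : ENNReal.ofReal (‖c‖ - r) ≤ hsENorm s f := by
  refine le_trans ?_ (enorm_torusFourierCoeff_zero_le s f)
  rw [← ofReal_norm]
  apply ENNReal.ofReal_le_ofReal
  have h1 := torusFourierCoeff_norm_le h 0
  rw [torusFourierCoeff_sub hf (integrable_const c), torusFourierCoeff_const, if_pos rfl] at h1
  have := norm_sub_norm_le c (torusFourierCoeff f 0)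
  rw [norm_sub_rev] at this
  linarith

lemma hsENorm_im_le (s : ℝ) {f : Torus2 → ℂ} (hf : Integrable f) :
    hsENorm s (fun x => ((f x).im : ℂ)) ≤ hsENorm s f := by
  have hc : Integrable fun x => conj (f x) :=
    Complex.conjLIE.toContinuousLinearEquiv.toContinuousLinearMap.integrable_comp hf
  have e : (fun x => ((f x).im : ℂ)) =
      fun x => (-Complex.I / 2) * f x + (Complex.I / 2) * conj (f x) := by
    ext x
    apply Complex.ext <;> simp <;> ring
  rw [e]
  refine (hsENorm_add_le s (hf.const_mul _) (hc.const_mul _)).trans ?_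
  rw [hsENorm_const_mul, hsENorm_const_mul, hsENorm_conj, ← add_mul]
  refine mul_le_of_le_one_left zero_le (le_of_eq ?_)
  rw [← ofReal_norm, ← ofReal_norm, ← ENNReal.ofReal_add (norm_nonneg _) (norm_nonneg _)]
  norm_num

/-- The multiplier satisfies `k_j² ≤ ⟨k⟩²`. -/
lemma hsENorm_gradient_le {s : ℝ} {Θ g : Torus2 → ℂ} {j : Fin 2}
    (h : ∀ k, torusFourierCoeff g k = Complex.I * k j * torusFourierCoeff Θ k) :
    hsENorm (s - 1) g ≤ hsENorm s Θ := by
  rw [← ENNReal.pow_le_pow_left_iff two_ne_zero, hsENorm_sq, hsENorm_sq]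
  refine ENNReal.tsum_le_tsum fun k => ?_
  have hJ := japaneseSq_pos k
  rw [enorm_sq_eq_ofReal, enorm_sq_eq_ofReal, ← ENNReal.ofReal_mul (by positivity),
    ← ENNReal.ofReal_mul (by positivity)]
  apply ENNReal.ofReal_le_ofReal
  rw [h, norm_mul, norm_mul, Complex.norm_I, one_mul, mul_pow, Complex.norm_intCast, sq_abs,
    ← mul_assoc]
  gcongr
  calc japaneseSq k ^ (s - 1) * (k j : ℝ) ^ 2 ≤ japaneseSq k ^ (s - 1) * japaneseSq k := by
        gcongr
        have : (k j : ℝ) ^ 2 ≤ ∑ i, (k i : ℝ) ^ 2 :=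
          Finset.single_le_sum (f := fun i => (k i : ℝ) ^ 2) (fun i _ => sq_nonneg _)
            (Finset.mem_univ j)
        rw [japaneseSq]; linarith
    _ = japaneseSq k ^ s := by
        rw [← Real.rpow_add_one hJ.ne']; congr 1; ring

/-- Away from `k = 0` integrality gives `|k|² ≥ 1`, so `⟨k⟩² ≤ 2|k|²`; the zeroth mode is invisible
to the gradient and stays as a separate term. -/
lemma hsENorm_le_gradient {s : ℝ} {Θ : Torus2 → ℂ} {g : Fin 2 → Torus2 → ℂ}
    (h : ∀ j k, torusFourierCoeff (g j) k = Complex.I * k j * torusFourierCoeff Θ k) :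
    hsENorm s Θ ≤ ‖torusFourierCoeff Θ 0‖ₑ +
      2 * (hsENorm (s - 1) (g 0) + hsENorm (s - 1) (g 1)) := by
  have hsq : hsENorm s Θ ^ 2 ≤ ‖torusFourierCoeff Θ 0‖ₑ ^ 2 +
      (2 * hsENorm (s - 1) (g 0) ^ 2 + 2 * hsENorm (s - 1) (g 1) ^ 2) := by
    have h0 : ‖torusFourierCoeff Θ 0‖ₑ ^ 2 =
        ∑' k : Fin 2 → ℤ, if k = 0 then ‖torusFourierCoeff Θ 0‖ₑ ^ 2 else 0 :=
      (tsum_ite_eq (0 : Fin 2 → ℤ) fun _ => ‖torusFourierCoeff Θ 0‖ₑ ^ 2).symm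
    rw [h0, hsENorm_sq, hsENorm_sq, hsENorm_sq, ← ENNReal.tsum_mul_left, ← ENNReal.tsum_mul_left,
      ← ENNReal.tsum_add, ← ENNReal.tsum_add]
    refine ENNReal.tsum_le_tsum fun k => ?_
    by_cases hk : k = 0
    · subst hk
      refine le_trans ?_ le_self_add
      simp [japaneseSq]
    · rw [if_neg hk, zero_add]
      have hJ := japaneseSq_pos k
      simp only [enorm_sq_eq_ofReal]
      rw [← ENNReal.ofReal_mul (by positivity), ← ENNReal.ofReal_mul (by positivity),
        ← ENNReal.ofReal_mul (by positivity), ← mul_add,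
        ← ENNReal.ofReal_add (by positivity) (by positivity), ← ENNReal.ofReal_ofNat,
        ← ENNReal.ofReal_mul (by norm_num)]
      apply ENNReal.ofReal_le_ofReal
      simp only [h, norm_mul, Complex.norm_I, one_mul, mul_pow, Complex.norm_intCast, sq_abs]
      have h1 : japaneseSq k ^ s = japaneseSq k ^ (s - 1) * japaneseSq k := by
        rw [← Real.rpow_add_one hJ.ne']; congr 1; ring
      have h2 : japaneseSq k ≤ 2 * ((k 0 : ℝ) ^ 2 + (k 1 : ℝ) ^ 2) := by
        rw [japaneseSq, Fin.sum_univ_two]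
        have : (1 : ℤ) ≤ (k 0) ^ 2 + (k 1) ^ 2 := by
          by_contra hlt
          apply hk
          have a0 : k 0 = 0 := by
            by_contra hne
            have := sq_pos_of_ne_zero hne
            have := sq_nonneg (k 1)
            omega
          have a1 : k 1 = 0 := by
            by_contra hne
            have := sq_pos_of_ne_zero hne
            have := sq_nonneg (k 0)
            omega
          ext i
          fin_cases i
          · exact a0
          · exact a1
        have : (1 : ℝ) ≤ (k 0 : ℝ) ^ 2 + (k 1 : ℝ) ^ 2 := by exact_mod_cast this
        linarith
      rw [h1]
      have hp : 0 ≤ japaneseSq k ^ (s - 1) := by positivity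
      calc japaneseSq k ^ (s - 1) * japaneseSq k * ‖torusFourierCoeff Θ k‖ ^ 2
          ≤ japaneseSq k ^ (s - 1) * (2 * ((k 0 : ℝ) ^ 2 + (k 1 : ℝ) ^ 2)) *
            ‖torusFourierCoeff Θ k‖ ^ 2 := by gcongr
        _ = _ := by ring
  rw [← ENNReal.pow_le_pow_left_iff two_ne_zero]
  refine hsq.trans ?_
  set a := ‖torusFourierCoeff Θ 0‖ₑ
  set b := hsENorm (s - 1) (g 0)
  set d := hsENorm (s - 1) (g 1)
  have : (a + 2 * (b + d)) ^ 2 = a ^ 2 + (2 * b ^ 2 + 2 * d ^ 2) +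
    (2 * b ^ 2 + 2 * d ^ 2 + 8 * b * d + 4 * a * (b + d)) := by ring
  rw [this]
  exact le_self_add

/-! ### Estimates for the Madelung variables -/

/-- The tame product estimate for `u ū`. -/
lemma exists_hsENorm_normSq_le {s : ℝ} (hs : 0 < s) (r : ℝ) :
    ∃ C : ℝ, 0 ≤ C ∧ ∀ u : Torus2 → ℂ, AEStronglyMeasurable u volume → (∀ᵐ x, ‖u x‖ ≤ r) →
      hsENorm s (fun x => ((‖u x‖ ^ 2 : ℝ) : ℂ)) ≤ ENNReal.ofReal C * hsENorm s u := by
  obtain ⟨C, hC1, hC⟩ := exists_hsENorm_mul_le hs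
  refine ⟨C * (2 * max r 0), by positivity, fun u hu hr => ?_⟩
  have hr' : ∀ᵐ x, ‖u x‖ ≤ max r 0 := hr.mono fun x hx => hx.trans (le_max_left _ _)
  have := hC u (fun x => conj (u x)) _ _ hu (Complex.continuous_conj.comp_aestronglyMeasurable hu)
    hr' (hr'.mono fun x hx => by rwa [RCLike.norm_conj])
  simp only [Complex.mul_conj, Complex.normSq_eq_norm_sq, hsENorm_conj] at this
  refine this.trans (le_of_eq ?_)
  rw [ENNReal.ofReal_mul (by positivity), ENNReal.ofReal_mul (by norm_num), ENNReal.ofReal_ofNat]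
  ring

lemma norm_log_div_le {c u : ℂ} (hc0 : c ≠ 0) (h : ‖u - c‖ ≤ ‖c‖ / 2) :
    ‖Complex.log (u / c)‖ ≤ 1 := by
  have h1 := norm_div_sub_one_le hc0 h
  have h2 := Complex.norm_log_one_add_half_le_self h1
  rw [add_sub_cancel] at h2
  linarith

lemma hsENorm_affine_le (s : ℝ) {f : Torus2 → ℂ} (hf : Integrable f) (a : ℂ) :
    hsENorm s (fun x => f x / a - 1) ≤ ENNReal.ofReal ‖a‖⁻¹ * hsENorm s f + 1 := by
  have e : (fun x => f x / a - 1) = fun x => a⁻¹ * f x + (-1) := by ext x; ring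
  rw [e]
  refine (hsENorm_add_le s (hf.const_mul _) (integrable_const _)).trans ?_
  rw [hsENorm_const_mul, hsENorm_const, ← ofReal_norm, norm_inv, enorm_neg, enorm_one]

/-- The argument is the imaginary part of `log(1 + w)` with `w = u/c - 1`, `|w| ≤ 1/2`. The constant
`-1` in `w` is absorbed by the mean of `u`, of modulus at least `r/2`. -/
lemma exists_hsENorm_arg_le {s r : ℝ} (hs : 0 < s) (hr : 0 < r) :
    ∃ C : ℝ, 0 ≤ C ∧ ∀ (u : Torus2 → ℂ) (c : ℂ), AEStronglyMeasurable u volume → Integrable u →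
      ‖c‖ = r → (∀ᵐ x, ‖u x - c‖ ≤ r / 2) →
      hsENorm s (fun x => ((u x / c).arg : ℂ)) ≤ ENNReal.ofReal C * hsENorm s u := by
  obtain ⟨C, hC0, hC⟩ := exists_hsENorm_log_le hs (r := 1 / 2) (by norm_num) (by norm_num)
  refine ⟨C * (r⁻¹ + 2 / r), by positivity, fun u c hu hui hc hb => ?_⟩
  have hc0 : c ≠ 0 := norm_pos_iff.mp (hc ▸ hr)
  have hw : AEStronglyMeasurable (fun x => u x / c - 1) volume := by
    have e : (fun x => u x / c - 1) = fun x => c⁻¹ * u x + (-1) := by ext x; ring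
    rw [e]
    exact (hu.const_mul _).add aestronglyMeasurable_const
  have hwb : ∀ᵐ x, ‖u x / c - 1‖ ≤ 1 / 2 :=
    hb.mono fun x hx => norm_div_sub_one_le hc0 (by rwa [hc])
  have h1 := hC _ hw hwb
  have e : ∀ x, 1 + (u x / c - 1) = u x / c := fun x => by ring
  simp only [e] at h1
  have hli : Integrable fun x => Complex.log (u x / c) := by
    refine Integrable.of_bound (C := 1) ?_ (hb.mono fun x hx => norm_log_div_le hc0 (by rwa [hc]))
    exact (Complex.measurable_log.comp_aemeasurable (hu.aemeasurable.div_const c)).aestronglyMeasurable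
  have h2 := (hsENorm_im_le s hli).trans h1
  simp only [Complex.log_im] at h2
  refine h2.trans ?_
  have h3 := hsENorm_affine_le s hui c
  have h4 := ofReal_le_hsENorm s hui hb
  rw [hc] at h3 h4
  have h5 : 1 ≤ ENNReal.ofReal (2 / r) * hsENorm s u := by
    calc (1 : ℝ≥0∞) = ENNReal.ofReal (2 / r) * ENNReal.ofReal (r - r / 2) := by
          rw [← ENNReal.ofReal_mul (by positivity), ← ENNReal.ofReal_one]
          congr 1; field_simp; norm_num
      _ ≤ _ := by gcongr
  calc ENNReal.ofReal C * hsENorm s (fun x => u x / c - 1)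
      ≤ ENNReal.ofReal C * (ENNReal.ofReal r⁻¹ * hsENorm s u +
        ENNReal.ofReal (2 / r) * hsENorm s u) := by
        gcongr
        exact h3.trans (by gcongr)
    _ = _ := by
        rw [ENNReal.ofReal_mul hC0, ENNReal.ofReal_add (by positivity) (by positivity)]
        ring

/-- The density lies in `[r²/4, 9r²/4]`, within `r²` of the midpoint `5r²/4`, which leaves a mean of
at least `r²/4`. -/
lemma one_le_hsENorm_normSq {s r : ℝ} (hr : 0 < r) {u : Torus2 → ℂ}
    (hu : AEStronglyMeasurable u volume) (h1 : ∀ᵐ x, r / 2 ≤ ‖u x‖)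
    (h2 : ∀ᵐ x, ‖u x‖ ≤ 3 / 2 * r) :
    1 ≤ ENNReal.ofReal (4 / r ^ 2) * hsENorm s (fun x => ((‖u x‖ ^ 2 : ℝ) : ℂ)) := by
  have hb : ∀ᵐ x, ‖((‖u x‖ ^ 2 : ℝ) : ℂ) - ((5 / 4 * r ^ 2 : ℝ) : ℂ)‖ ≤ r ^ 2 := by
    filter_upwards [h1, h2] with x a b
    rw [← Complex.ofReal_sub, Complex.norm_real, Real.norm_eq_abs, abs_le]
    constructor <;> nlinarith
  have hi : Integrable fun x => ((‖u x‖ ^ 2 : ℝ) : ℂ) := by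
    refine Integrable.of_bound (C := (3 / 2 * r) ^ 2) ?_ ?_
    · exact Complex.continuous_ofReal.comp_aestronglyMeasurable (hu.norm.pow 2)
    · filter_upwards [h2] with x b
      rw [Complex.norm_real, norm_pow, norm_norm]
      gcongr
  have h := ofReal_le_hsENorm s hi hb
  rw [Complex.norm_real, Real.norm_eq_abs, abs_of_pos (by positivity)] at h
  calc (1 : ℝ≥0∞) = ENNReal.ofReal (4 / r ^ 2) * ENNReal.ofReal (5 / 4 * r ^ 2 - r ^ 2) := by
        rw [← ENNReal.ofReal_mul (by positivity), ← ENNReal.ofReal_one]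
        congr 1; field_simp; norm_num
    _ ≤ _ := by gcongr

/-- Inverts the Madelung variables through `u = c · exp(log|u/c| + i arg(u/c))`, where `log|u/c|` is
half the logarithm of `|u|²/r²`. -/
lemma exists_hsENorm_le_normSq_add_arg {s r : ℝ} (hs : 0 < s) (hr : 0 < r) :
    ∃ C : ℝ, 0 ≤ C ∧ ∀ (u : Torus2 → ℂ) (c : ℂ), AEStronglyMeasurable u volume →
      ‖c‖ = r → (∀ᵐ x, ‖u x - c‖ ≤ r / 2) →
      hsENorm s u ≤ ENNReal.ofReal C * (hsENorm s (fun x => ((‖u x‖ ^ 2 : ℝ) : ℂ)) +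
        hsENorm s (fun x => ((u x / c).arg : ℂ))) := by
  obtain ⟨L, hL0, hL⟩ := exists_hsENorm_log_le hs (r := 4 / 5) (by norm_num) (by norm_num)
  obtain ⟨E, hE0, hE⟩ := exists_hsENorm_exp_sub_one_le (r := 1) hs
  -- The ratio `|u|²/r²` may reach `9/4`, outside the disc where the logarithm series at `1`
  -- converges. Dividing by the midpoint `q` instead gives values in `[1/5, 9/5]`, hence radius
  -- `4/5`; the constant `l = log(5/4)` undoes the change.
  set q : ℝ := 5 / 4 * r ^ 2 with hq
  have hq0 : 0 < q := by positivity
  set l : ℝ := Real.log (5 / 4) with hl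
  have hl0 : 0 ≤ l := Real.log_nonneg (by norm_num)
  refine ⟨r * (4 / r ^ 2 + E * (1 / 2 * (L * (q⁻¹ + 4 / r ^ 2) + l * (4 / r ^ 2)) + 1)),
    by positivity, fun u c hu hc hb => ?_⟩
  have hc0 : c ≠ 0 := norm_pos_iff.mp (hc ▸ hr)
  set N := hsENorm s (fun x => ((‖u x‖ ^ 2 : ℝ) : ℂ)) with hN
  set T := hsENorm s (fun x => ((u x / c).arg : ℂ)) with hT
  have hlow : ∀ᵐ x, r / 2 ≤ ‖u x‖ := by
    filter_upwards [hb] with x hx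
    have := norm_sub_norm_le c (u x)
    rw [norm_sub_rev, hc] at this
    linarith
  have hup : ∀ᵐ x, ‖u x‖ ≤ 3 / 2 * r := by
    filter_upwards [hb] with x hx
    have := norm_sub_norm_le (u x) c
    rw [hc] at this
    linarith
  have hone : 1 ≤ ENNReal.ofReal (4 / r ^ 2) * N := one_le_hsENorm_normSq hr hu hlow hup
  have hρi : Integrable fun x => ((‖u x‖ ^ 2 : ℝ) : ℂ) := by
    refine Integrable.of_bound (C := (3 / 2 * r) ^ 2) ?_ ?_
    · exact Complex.continuous_ofReal.comp_aestronglyMeasurable (hu.norm.pow 2)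
    · filter_upwards [hup] with x b
      rw [Complex.norm_real, norm_pow, norm_norm]
      gcongr
  have hlm : AEStronglyMeasurable (fun x => Complex.log (u x / c)) volume :=
    (Complex.measurable_log.comp_aemeasurable (hu.aemeasurable.div_const c)).aestronglyMeasurable
  have hlb : ∀ᵐ x, ‖Complex.log (u x / c)‖ ≤ 1 :=
    hb.mono fun x hx => norm_log_div_le hc0 (by rwa [hc])
  have hli : Integrable fun x => Complex.log (u x / c) := Integrable.of_bound hlm 1 hlb
  -- the logarithm of the density
  have hwm : AEStronglyMeasurable (fun x => ((‖u x‖ ^ 2 : ℝ) : ℂ) / (q : ℂ) - 1) volume := by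
    have e : (fun x => ((‖u x‖ ^ 2 : ℝ) : ℂ) / (q : ℂ) - 1) =
        fun x => (q : ℂ)⁻¹ * ((‖u x‖ ^ 2 : ℝ) : ℂ) + (-1) := by ext x; ring
    rw [e]
    exact (hρi.1.const_mul _).add aestronglyMeasurable_const
  have hwb : ∀ᵐ x, ‖((‖u x‖ ^ 2 : ℝ) : ℂ) / (q : ℂ) - 1‖ ≤ 4 / 5 := by
    filter_upwards [hlow, hup] with x a b
    rw [← Complex.ofReal_div, ← Complex.ofReal_one, ← Complex.ofReal_sub, Complex.norm_real,
      Real.norm_eq_abs, abs_le]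
    have h1 : (1 / 5 : ℝ) ≤ ‖u x‖ ^ 2 / q := by
      rw [le_div_iff₀ hq0, hq]; nlinarith
    have h2 : ‖u x‖ ^ 2 / q ≤ 9 / 5 := by
      rw [div_le_iff₀ hq0, hq]; nlinarith
    constructor <;> linarith
  have hlog1 := hL _ hwm hwb
  have hlog2 : hsENorm s (fun x => ((Complex.log (u x / c)).re : ℂ)) ≤
      ENNReal.ofReal (1 / 2 * (L * (q⁻¹ + 4 / r ^ 2) + l * (4 / r ^ 2))) * N := by
    have e : (fun x => ((Complex.log (u x / c)).re : ℂ)) =ᵐ[volume] fun x =>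
        (1 / 2 : ℂ) * (Complex.log (1 + (((‖u x‖ ^ 2 : ℝ) : ℂ) / (q : ℂ) - 1)) + (l : ℂ)) := by
      filter_upwards [hlow] with x a
      have hx : 0 < ‖u x‖ := by linarith
      rw [Complex.log_re, norm_div, hc, add_sub_cancel, ← Complex.ofReal_div,
        ← Complex.ofReal_log (by positivity), hl]
      norm_cast
      rw [← Real.log_mul (by positivity) (by norm_num)]
      have : ‖u x‖ ^ 2 / q * (5 / 4) = (‖u x‖ / r) ^ 2 := by rw [hq]; field_simp
      rw [this, Real.log_pow]
      push_cast; ring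
    rw [hsENorm_congr_ae e, hsENorm_const_mul]
    have hli' : Integrable fun x =>
        Complex.log (1 + (((‖u x‖ ^ 2 : ℝ) : ℂ) / (q : ℂ) - 1)) := by
      have e2 : (fun x => Complex.log (1 + (((‖u x‖ ^ 2 : ℝ) : ℂ) / (q : ℂ) - 1))) =ᵐ[volume]
          fun x => 2 * ((Complex.log (u x / c)).re : ℂ) - l := by
        filter_upwards [e] with x hx
        rw [hx]; ring
      exact ((hli.re.ofReal.const_mul 2).sub (integrable_const _)).congr e2.symm
    have hadd := hsENorm_add_le s hli' (integrable_const (l : ℂ))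
    rw [hsENorm_const] at hadd
    have h3 := hsENorm_affine_le s hρi (q : ℂ)
    rw [Complex.norm_real, Real.norm_eq_abs, abs_of_pos hq0] at h3
    have hlE : ‖(l : ℂ)‖ₑ = ENNReal.ofReal l := by
      rw [← ofReal_norm, Complex.norm_real, Real.norm_eq_abs, abs_of_nonneg hl0]
    have hhalf : ‖(1 / 2 : ℂ)‖ₑ = ENNReal.ofReal (1 / 2) := by
      rw [← ofReal_norm]; norm_num
    rw [hlE] at hadd
    rw [hhalf]
    calc _ ≤ ENNReal.ofReal (1 / 2) * (ENNReal.ofReal L * (ENNReal.ofReal q⁻¹ * N +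
          ENNReal.ofReal (4 / r ^ 2) * N) + ENNReal.ofReal l * (ENNReal.ofReal (4 / r ^ 2) * N)) := by
          gcongr
          refine hadd.trans ?_
          gcongr
          · refine hlog1.trans ?_
            gcongr
            exact h3.trans (by gcongr)
          · exact le_mul_of_one_le_right zero_le hone
      _ = _ := by
          rw [ENNReal.ofReal_mul (p := 1 / 2) (by norm_num),
            ENNReal.ofReal_add (p := L * (q⁻¹ + 4 / r ^ 2)) (by positivity) (by positivity),
            ENNReal.ofReal_mul hL0, ENNReal.ofReal_mul hl0,
            ENNReal.ofReal_add (p := q⁻¹) (by positivity) (by positivity)]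
          ring
  set K := 1 / 2 * (L * (q⁻¹ + 4 / r ^ 2) + l * (4 / r ^ 2)) with hK
  have hK0 : 0 ≤ K := by positivity
  have hlog : hsENorm s (fun x => Complex.log (u x / c)) ≤ ENNReal.ofReal K * N + T := by
    have e : (fun x => Complex.log (u x / c)) = fun x =>
        ((Complex.log (u x / c)).re : ℂ) + Complex.I * ((u x / c).arg : ℂ) := by
      ext x
      rw [← Complex.log_im, mul_comm, Complex.re_add_im]
    rw [e]
    have hai : Integrable fun x => ((u x / c).arg : ℂ) := by
      have h : Integrable fun x => ((Complex.log (u x / c)).im : ℂ) := hli.im.ofReal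
      simpa only [Complex.log_im] using h
    refine (hsENorm_add_le s (hli.re.ofReal) (hai.const_mul _)).trans ?_
    rw [hsENorm_const_mul, ← ofReal_norm Complex.I, Complex.norm_I, ENNReal.ofReal_one, one_mul]
    gcongr
    exact hlog2
  have hexp := hE _ hlm hlb
  have hu_eq : u =ᵐ[volume] fun x => c * ((Complex.exp (Complex.log (u x / c)) - 1) + 1) := by
    filter_upwards [hlow] with x a
    have hx : u x ≠ 0 := norm_pos_iff.mp (by linarith)
    rw [Complex.exp_log (div_ne_zero hx hc0)]
    field_simp; ring
  have hei : Integrable fun x => Complex.exp (Complex.log (u x / c)) - 1 := by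
    refine Integrable.of_bound (C := Real.exp 1 + 1)
      ((Complex.continuous_exp.comp_aestronglyMeasurable hlm).sub aestronglyMeasurable_const) ?_
    filter_upwards [hlb] with x hx
    refine (norm_sub_le _ _).trans ?_
    rw [norm_one, Complex.norm_exp]
    gcongr
    exact (Complex.re_le_norm _).trans hx
  have h1 := hsENorm_add_le s hei (integrable_const (1 : ℂ))
  rw [hsENorm_const, enorm_one] at h1
  rw [hsENorm_congr_ae hu_eq, hsENorm_const_mul, ← ofReal_norm, hc]
  calc _ ≤ ENNReal.ofReal r * (ENNReal.ofReal E * (ENNReal.ofReal K * N + T) +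
        ENNReal.ofReal (4 / r ^ 2) * N) := by
        gcongr
        refine h1.trans ?_
        gcongr
        exact hexp.trans (by gcongr)
    _ ≤ ENNReal.ofReal r * (ENNReal.ofReal E * (ENNReal.ofReal K * (N + T) + (N + T)) +
        ENNReal.ofReal (4 / r ^ 2) * (N + T)) := by
        gcongr
        · exact le_self_add
        · exact le_add_self
        · exact le_self_add
    _ = _ := by
        rw [ENNReal.ofReal_mul (p := r) hr.le,
          ENNReal.ofReal_add (p := 4 / r ^ 2) (by positivity) (by positivity),
          ENNReal.ofReal_mul hE0, ENNReal.ofReal_add (p := K) hK0 (by norm_num),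
          ENNReal.ofReal_one]
        ring

lemma I_mul_torusFourierCoeff_add_const {f : Torus2 → ℝ} (hf : Continuous f) (d : ℝ) (j : Fin 2)
    (k : Fin 2 → ℤ) :
    Complex.I * k j * torusFourierCoeff (fun x => ((f x + d : ℝ) : ℂ)) k =
      Complex.I * k j * torusFourierCoeff (fun x => (f x : ℂ)) k := by
  have hc : Continuous fun x => (f x : ℂ) := by fun_prop
  simp only [Complex.ofReal_add]
  rw [torusFourierCoeff_add hc.integrable_torus (integrable_const _), torusFourierCoeff_const]
  by_cases hk : k = 0
  · simp [hk]
  · simp [hk]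

lemma summable_gradient_of_hsENorm_ne_top {s : ℝ} (hs : 1 ≤ s) {f : Torus2 → ℂ}
    (h : hsENorm s f ≠ ⊤) (j : Fin 2) :
    Summable fun k : Fin 2 → ℤ => ‖Complex.I * k j * torusFourierCoeff f k‖ ^ 2 := by
  refine Summable.of_nonneg_of_le (fun k => sq_nonneg _) (fun k => ?_)
    (summable_of_hsENorm_ne_top h)
  rw [norm_mul, norm_mul, Complex.norm_I, one_mul, mul_pow, Complex.norm_intCast, sq_abs]
  gcongr
  have h1 : (k j : ℝ) ^ 2 ≤ ∑ i, (k i : ℝ) ^ 2 :=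
    Finset.single_le_sum (f := fun i => (k i : ℝ) ^ 2) (fun i _ => sq_nonneg _) (Finset.mem_univ j)
  calc (k j : ℝ) ^ 2 ≤ japaneseSq k := by rw [japaneseSq]; linarith
    _ = japaneseSq k ^ (1 : ℝ) := (Real.rpow_one _).symm
    _ ≤ japaneseSq k ^ s := Real.rpow_le_rpow_of_exponent_le (one_le_japaneseSq k) hs

/-- An integrable function with finite `H^s` norm, `s ≥ 0`, is square integrable. -/
lemma memLp_two_of_hsENorm_ne_top {s : ℝ} (hs : 0 ≤ s) {f : Torus2 → ℂ} (hf : Integrable f)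
    (h : hsENorm s f ≠ ⊤) : MemLp f 2 volume := by
  have hsum : Summable fun k => ‖torusFourierCoeff f k‖ ^ 2 := by
    refine Summable.of_nonneg_of_le (fun k => sq_nonneg _) (fun k => ?_)
      (summable_of_hsENorm_ne_top h)
    exact le_mul_of_one_le_left (sq_nonneg _) (Real.one_le_rpow (one_le_japaneseSq k) hs)
  obtain ⟨F, hF, hFc⟩ := exists_memLp_torusFourierCoeff_eq hsum
  have hFi : Integrable F := hF.integrable (by norm_num)
  have hz := ae_eq_zero_of_torusFourierCoeff_eq_zero (hf.sub hFi) fun k =>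
    (torusFourierCoeff_sub hf hFi k).trans (by rw [hFc, sub_self])
  refine hF.ae_eq ?_
  filter_upwards [hz] with x hx
  exact (sub_eq_zero.mp hx).symm

/-- The final arithmetic, with `U`, `R`, `g₀`, `g₁` standing for the norms of `u`, the density and
the two phase derivatives. The first bound uses `ε ≤ 1` to drop `ε` from the velocity; in the
second, `ε⁻¹` restores the gradient and `ε ≤ 1` protects the density term. -/
lemma velocity_norm_comparison {A B a D ε U R g₀ g₁ : ℝ} (hA : 0 ≤ A) (hB : 0 ≤ B) (ha : 0 ≤ a)
    (hD : 0 ≤ D) (hε : 0 < ε) (hε1 : ε ≤ 1) (hU : 0 ≤ U) (hR : 0 ≤ R) (hg₀ : 0 ≤ g₀)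
    (hg₁ : 0 ≤ g₁) (h1 : R ≤ A * U) (h2 : g₀ ≤ B * U) (h3 : g₁ ≤ B * U)
    (h4 : U ≤ a * R + 2 * D * (g₀ + g₁)) :
    (2 + A + 2 * B + a + 4 * D)⁻¹ * (2 * Real.pi * R + Real.sqrt ((2 * Real.pi * (ε * g₀)) ^ 2 +
        (2 * Real.pi * (ε * g₁)) ^ 2)) ≤ 2 * Real.pi * U ∧
      2 * Real.pi * U ≤ (2 + A + 2 * B + a + 4 * D) * ε⁻¹ * (2 * Real.pi * R +
        Real.sqrt ((2 * Real.pi * (ε * g₀)) ^ 2 + (2 * Real.pi * (ε * g₁)) ^ 2)) := by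
  have hpi := Real.pi_pos
  set p := 2 * Real.pi * (ε * g₀) with hp
  set q := 2 * Real.pi * (ε * g₁) with hq
  have hp0 : 0 ≤ p := by positivity
  have hq0 : 0 ≤ q := by positivity
  set S := Real.sqrt (p ^ 2 + q ^ 2) with hS
  have hS0 : p ≤ S := Real.le_sqrt_of_sq_le (le_add_of_nonneg_right (sq_nonneg _))
  have hS1 : q ≤ S := Real.le_sqrt_of_sq_le (le_add_of_nonneg_left (sq_nonneg _))
  have hSle : S ≤ p + q :=
    Real.sqrt_le_iff.mpr ⟨by positivity, by nlinarith [mul_nonneg hp0 hq0]⟩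
  have hSnn : 0 ≤ S := Real.sqrt_nonneg _
  have hM : 0 < 2 + A + 2 * B + a + 4 * D := by positivity
  constructor
  · rw [inv_mul_le_iff₀ hM]
    have e0 : p ≤ 2 * Real.pi * (B * U) :=
      mul_le_mul_of_nonneg_left ((mul_le_of_le_one_left hg₀ hε1).trans h2) (by positivity)
    have e1 : q ≤ 2 * Real.pi * (B * U) :=
      mul_le_mul_of_nonneg_left ((mul_le_of_le_one_left hg₁ hε1).trans h3) (by positivity)
    have e2 : 2 * Real.pi * R ≤ 2 * Real.pi * (A * U) :=
      mul_le_mul_of_nonneg_left h1 (by positivity)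
    calc 2 * Real.pi * R + S ≤ (A + 2 * B) * (2 * Real.pi * U) := by linarith
      _ ≤ _ := mul_le_mul_of_nonneg_right (by linarith) (by positivity)
  · rw [mul_right_comm (2 + A + 2 * B + a + 4 * D), ← div_eq_mul_inv, le_div_iff₀ hε]
    have e0 : 2 * Real.pi * U * ε ≤ 2 * Real.pi * (a * R + 2 * D * (g₀ + g₁)) * ε := by gcongr
    have e1 : a * (2 * Real.pi * R) * ε ≤ a * (2 * Real.pi * R) * 1 := by gcongr
    have e2 : 2 * D * (p + q) ≤ 2 * D * (S + S) := by gcongr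
    have e3 : 2 * Real.pi * (a * R + 2 * D * (g₀ + g₁)) * ε =
        a * (2 * Real.pi * R) * ε + 2 * D * (p + q) := by rw [hp, hq]; ring
    have e4 : a * (2 * Real.pi * R) ≤ (2 + A + 2 * B + a + 4 * D) * (2 * Real.pi * R) :=
      mul_le_mul_of_nonneg_right (by linarith) (by positivity)
    have e5 : 4 * D * S ≤ (2 + A + 2 * B + a + 4 * D) * S :=
      mul_le_mul_of_nonneg_right (by linarith) hSnn
    linarith

/-! ### Equivalence of the Sobolev and Madelung norms -/

theorem proposition2p1 (s m : ℝ) (hs : 1 < s) (hm : 0 < m) :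
    ∃ M : ℝ, 1 < M ∧
      ∀ (ε φ : ℝ) (u : Torus2 → ℂ), 0 < ε → ε ≤ 1 → MemHs s u →
        eLpNorm (fun x => u x - (Real.sqrt m : ℂ) * Complex.exp (Complex.I * (φ : ℂ))) ∞ volume
          ≤ ENNReal.ofReal (Real.sqrt m / 2) →
        (∃ (ρ : Torus2 → ℝ) (v : Fin 2 → Torus2 → ℝ), IsMadelungTransform ε u ρ v) ∧
        ∀ (ρ : Torus2 → ℝ) (v : Fin 2 → Torus2 → ℝ), IsMadelungTransform ε u ρ v →
          MemMs s ρ v ∧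
          M⁻¹ * msNorm s ρ v ≤ hsNorm s u ∧
          hsNorm s u ≤ M * ε⁻¹ * msNorm s ρ v := by
  have hs0 : 0 < s := by linarith
  set r := Real.sqrt m with hr_def
  have hr : 0 < r := Real.sqrt_pos.mpr hm
  obtain ⟨A, hA0, hA⟩ := exists_hsENorm_normSq_le hs0 (3 / 2 * r)
  obtain ⟨B, hB0, hB⟩ := exists_hsENorm_arg_le hs0 hr
  obtain ⟨D, hD0, hD⟩ := exists_hsENorm_le_normSq_add_arg hs0 hr
  -- The coefficient of the density once the zeroth mode of the phase, at most `π`, has been bounded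
  -- by `π(4/r²)` times the norm of the density.
  set a : ℝ := D * (1 + Real.pi * (4 / r ^ 2)) with ha
  have ha0 : 0 ≤ a := by positivity
  refine ⟨2 + A + 2 * B + a + 4 * D, by linarith, fun ε φ u hε hε1 hu hub => ?_⟩
  obtain ⟨hu2, hus⟩ := memHs_iff.mp hu
  set c : ℂ := (r : ℂ) * Complex.exp (Complex.I * (φ : ℂ)) with hc_def
  have hc : ‖c‖ = r := by
    rw [hc_def, norm_mul, Complex.norm_real, Real.norm_eq_abs, abs_of_pos hr, mul_comm Complex.I,
      Complex.norm_exp_ofReal_mul_I, mul_one]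
  have hc0 : c ≠ 0 := norm_pos_iff.mp (hc ▸ hr)
  have hui : Integrable u := hu2.integrable (by norm_num)
  have hb : ∀ᵐ x, ‖u x - c‖ ≤ r / 2 := by
    have h1 := ae_le_eLpNormEssSup (f := fun x => u x - c) (μ := (volume : Measure Torus2))
    rw [eLpNorm_exponent_top] at hub
    filter_upwards [h1] with x hx
    have h2 := hx.trans hub
    rw [← ofReal_norm] at h2
    exact (ENNReal.ofReal_le_ofReal_iff (by positivity)).mp h2
  have hlow : ∀ᵐ x, r / 2 ≤ ‖u x‖ := by
    filter_upwards [hb] with x hx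
    have := norm_sub_norm_le c (u x)
    rw [norm_sub_rev, hc] at this
    linarith
  have hup : ∀ᵐ x, ‖u x‖ ≤ 3 / 2 * r := by
    filter_upwards [hb] with x hx
    have := norm_sub_norm_le (u x) c
    rw [hc] at this
    linarith
  obtain ⟨Θ, hΘc, hΘ⟩ := exists_continuous_arg hs hui hus hc0 (by rwa [hc])
  have hΘae : (fun x => (Θ x : ℂ)) =ᵐ[volume] fun x => ((u x / c).arg : ℂ) := by
    filter_upwards [hΘ] with x hx
    rw [hx]
  have hΘu : hsENorm s (fun x => (Θ x : ℂ)) ≤ ENNReal.ofReal B * hsENorm s u := by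
    rw [hsENorm_congr_ae hΘae]; exact hB u c hu2.1 hui hc hb
  have hΘfin : hsENorm s (fun x => (Θ x : ℂ)) ≠ ⊤ :=
    ne_top_of_le_ne_top (ENNReal.mul_ne_top ENNReal.ofReal_ne_top hus) hΘu
  have hphase : ∀ᵐ x, u x = ‖u x‖ * Complex.exp (Complex.I * ((Θ x + φ : ℝ) : ℂ)) := by
    filter_upwards [hΘ] with x hx
    rw [hx, add_comm]
    exact eq_norm_mul_exp_arg_div hc0 (by rw [hc])
  refine ⟨?_, ?_⟩
  · have hcont : Continuous fun x => Θ x + φ := hΘc.add continuous_const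
    have hcC : Continuous fun x => ((Θ x + φ : ℝ) : ℂ) := by fun_prop
    obtain ⟨g, hg⟩ := exists_isWeakGradient (θ := fun x => Θ x + φ)
      (hcC.memLp_of_hasCompactSupport (HasCompactSupport.of_compactSpace _)) (fun j => by
        simp only [I_mul_torusFourierCoeff_add_const hΘc]
        exact summable_gradient_of_hsENorm_ne_top hs.le hΘfin j)
    exact ⟨fun x => ‖u x‖ ^ 2, fun j x => ε * g j x, fun _ => rfl, _, g, hcont, hphase, hg,
      fun _ _ => rfl⟩
  · rintro ρ v ⟨hρ, θ, g, hθc, hθ, hg, hv⟩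
    have hρe : (fun x => (ρ x : ℂ)) = fun x => ((‖u x‖ ^ 2 : ℝ) : ℂ) := by
      ext x; rw [hρ]
    have hve : ∀ j, (fun x => (v j x : ℂ)) = fun x => (ε : ℂ) * (g j x : ℂ) := by
      intro j; ext x; rw [hv, Complex.ofReal_mul]
    have hu0 : ∀ᵐ x, u x ≠ 0 := by
      filter_upwards [hlow] with x hx
      exact norm_pos_iff.mp (by linarith)
    -- An arbitrary phase may have a large mean, so the estimates are run with `Θ`, which takes its
    -- values from `arg`; the constant `φ + d` does not affect the gradient.
    obtain ⟨d, hd⟩ : ∃ d, ∀ x, θ x = Θ x + φ + d := phase_unique hu0 hθc (hΘc.add continuous_const) hθ hphase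
    have hgc : ∀ j k, torusFourierCoeff (fun x => (g j x : ℂ)) k =
        Complex.I * k j * torusFourierCoeff (fun x => (Θ x : ℂ)) k := by
      intro j k
      rw [hg.torusFourierCoeff, ← I_mul_torusFourierCoeff_add_const hΘc (φ + d)]
      simp only [hd, add_assoc]
    set U := hsENorm s u
    set R := hsENorm s (fun x => ((‖u x‖ ^ 2 : ℝ) : ℂ)) with hR
    set T := hsENorm s (fun x => (Θ x : ℂ)) with hT
    set G := fun j => hsENorm (s - 1) (fun x => (g j x : ℂ)) with hG
    have hRU : R ≤ ENNReal.ofReal A * U := hA u hu2.1 hup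
    have hRfin : R ≠ ⊤ := ne_top_of_le_ne_top (ENNReal.mul_ne_top ENNReal.ofReal_ne_top hus) hRU
    have hGT : ∀ j, G j ≤ T := fun j => hsENorm_gradient_le (hgc j)
    have hGfin : ∀ j, G j ≠ ⊤ := fun j => ne_top_of_le_ne_top hΘfin (hGT j)
    have hUT : U ≤ ENNReal.ofReal D * (R + T) := by
      rw [hT, hsENorm_congr_ae hΘae]; exact hD u c hu2.1 hc hb
    have hone : 1 ≤ ENNReal.ofReal (4 / r ^ 2) * R := one_le_hsENorm_normSq hr hu2.1 hlow hup
    have hTG : T ≤ ENNReal.ofReal Real.pi * (ENNReal.ofReal (4 / r ^ 2) * R) +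
        2 * (G 0 + G 1) := by
      refine (hsENorm_le_gradient hgc).trans ?_
      gcongr
      refine le_trans ?_ (le_mul_of_one_le_right zero_le hone)
      rw [← ofReal_norm]
      apply ENNReal.ofReal_le_ofReal
      apply torusFourierCoeff_norm_le
      filter_upwards [hΘ] with x hx
      rw [Complex.norm_real, hx]
      exact Complex.abs_arg_le_pi _
    have hGv : ∀ j, hsENorm (s - 1) (fun x => (v j x : ℂ)) = ENNReal.ofReal ε * G j := by
      intro j
      rw [hve, hsENorm_const_mul, ← ofReal_norm, Complex.norm_real, Real.norm_eq_abs,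
        abs_of_pos hε]
    have hvfin : ∀ j, hsENorm (s - 1) (fun x => (v j x : ℂ)) ≠ ⊤ := by
      intro j; rw [hGv]; exact ENNReal.mul_ne_top ENNReal.ofReal_ne_top (hGfin j)
    refine ⟨⟨?_, fun j => memHs_iff.mpr ⟨?_, hvfin j⟩⟩, ?_⟩
    · rw [hρe]
      refine memHs_iff.mpr ⟨?_, hRfin⟩
      refine memLp_two_of_bound (a := (3 / 2 * r) ^ 2)
        (Complex.continuous_ofReal.comp_aestronglyMeasurable (hu2.1.norm.pow 2)) ?_
      filter_upwards [hup] with x hx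
      rw [Complex.norm_real, norm_pow, norm_norm]
      gcongr
    · rw [hve]
      -- The weak gradient is only assumed integrable; its square integrability comes from the
      -- finite `H^{s-1}` norm and uniqueness of Fourier coefficients.
      exact (memLp_two_of_hsENorm_ne_top (by linarith) (hg.2 j).1.ofReal (hGfin j)).const_mul _
    -- real-valued versions of the estimates
    have hgr : ∀ j, 0 ≤ (G j).toReal := fun j => ENNReal.toReal_nonneg
    have hRr : 0 ≤ R.toReal := ENNReal.toReal_nonneg
    have hUr : 0 ≤ U.toReal := ENNReal.toReal_nonneg
    have e1 : R.toReal ≤ A * U.toReal := by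
      have := ENNReal.toReal_mono (ENNReal.mul_ne_top ENNReal.ofReal_ne_top hus) hRU
      rwa [ENNReal.toReal_mul, ENNReal.toReal_ofReal hA0] at this
    have e2 : ∀ j, (G j).toReal ≤ B * U.toReal := by
      intro j
      have := ENNReal.toReal_mono (ENNReal.mul_ne_top ENNReal.ofReal_ne_top hus)
        ((hGT j).trans hΘu)
      rwa [ENNReal.toReal_mul, ENNReal.toReal_ofReal hB0] at this
    have e3 : U.toReal ≤ a * R.toReal + 2 * D * ((G 0).toReal + (G 1).toReal) := by
      have h1 : U ≤ ENNReal.ofReal a * R + ENNReal.ofReal (2 * D) * (G 0 + G 1) := by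
        refine hUT.trans ((mul_le_mul_right (add_le_add_right hTG R) _).trans (le_of_eq ?_))
        rw [ha, ENNReal.ofReal_mul hD0, ENNReal.ofReal_add (by norm_num) (by positivity),
          ENNReal.ofReal_one, ENNReal.ofReal_mul Real.pi_pos.le,
          ENNReal.ofReal_mul (p := 2) (by norm_num), ENNReal.ofReal_ofNat]
        ring
      have hsum : G 0 + G 1 ≠ ⊤ := ENNReal.add_ne_top.mpr ⟨hGfin 0, hGfin 1⟩
      have hR' := ENNReal.mul_ne_top (ENNReal.ofReal_ne_top (r := a)) hRfin
      have hG' := ENNReal.mul_ne_top (ENNReal.ofReal_ne_top (r := 2 * D)) hsum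
      have := ENNReal.toReal_mono (ENNReal.add_ne_top.mpr ⟨hR', hG'⟩) h1
      rwa [ENNReal.toReal_add hR' hG', ENNReal.toReal_mul, ENNReal.toReal_mul,
        ENNReal.toReal_ofReal ha0, ENNReal.toReal_ofReal (by positivity),
        ENNReal.toReal_add (hGfin 0) (hGfin 1)] at this
    have hms : msNorm s ρ v = 2 * Real.pi * R.toReal +
        Real.sqrt ((2 * Real.pi * (ε * (G 0).toReal)) ^ 2 +
          (2 * Real.pi * (ε * (G 1).toReal)) ^ 2) := by
      rw [msNorm, hρe, hsNorm_eq hRfin, Fin.sum_univ_two, hsNorm_eq (hvfin 0),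
        hsNorm_eq (hvfin 1), hGv, hGv, ENNReal.toReal_mul, ENNReal.toReal_mul,
        ENNReal.toReal_ofReal hε.le]
    rw [hms, hsNorm_eq hus]
    exact velocity_norm_comparison hA0 hB0 ha0 hD0 hε hε1 hUr hRr (hgr 0) (hgr 1) e1 (e2 0) (e2 1) e3
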